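/- Let $d\ge 2$ and let $|\cdot|$ be the Euclidean norm. For $x\in\mathbb R^d$ write $x_{-k}\in\mathbb R^{d-1}$ for $x$ with its $k$-th coordinate removed. Let $\pi$ be a probability measure on $\mathbb R^d$, and for $1\le k\le d$ let $\pi(\cdot\mid x_{-k})$ (a Markov kernel, defined for every $x_{-k}\in\mathbb R^{d-1}$) be a version of the conditional distribution of $X_k$ given $X_{-k}=x_{-k}$, where $X\sim\pi$. Let $\|\mu-\nu\|_{TV}=\sup_S|\mu(S)-\nu(S)|$, and let $q\ge1$, $C>0$, $M>0$, $0<\beta\le1$. Assume: 1. ($L^q$-Poincaré inequality with constant $C$) $\mathbb E_\pi|f-\mathbb E_\pi f|^q\le C^{-1}\,\mathbb E_\pi|\nabla f|^q$ for every $\pi$-integrable $f:\mathbb R^d\to\mathbb R$ that is Lipschitz on every ball, where $|\nabla f|(x)=\limsup_{y\to x,\,y\ne x}|f(y)-f(x)|/|y-x|$ (the norm of the gradient wherever $f$ is differentiable); 2. ($(M,\beta)$-TV continuity) $\|\pi(\cdot\mid x_{-k})-\pi(\cdot\mid y_{-k})\|_{TV}\le M|x_{-k}-y_{-k}|^\beta$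 for all $k$ and all $x,y\in\mathbb R^d$. Let $P_k$ be the kernel that resamples the $k$-th coordinate of $x$ from $\pi(\cdot\mid x_{-k})$ and keeps the others, and let $P_{RS}=\frac1d\sum_{k=1}^dP_k$ be the random-scan Gibbs kernel. Let $$\Phi(P)=\inf\Big\{\tfrac{1}{\pi(S)}\int_SP(x,S^c)\,\pi(dx):\ 0<\pi(S)\le\tfrac12\Big\},\qquad \lambda_2(P)=\inf\Big\{\frac{\langle f,(I-P)f\rangle_{L^2(\pi)}}{\|f\|_{L^2(\pi)}^2}:\ 0\ne f\in L^2(\pi),\ \mathbb E_\pi f=0\Big\},$$ and, for an initial probability measure $\mu$, $\tau(\zeta,P)=\inf\{n\ge0:\|\mu P^n-\pi\|_{TV}\le\zeta\}$ (infima over the empty set are $+\infty$). Then there are constants $c,K>0$ such that $$\Phi(P_{RS})\ \ge\ \frac{c}{d\log d}\min\Big\{1,\frac{C}{M^{q/\beta}(d\log d)^{q/\beta}}\Big\},$$ $$\lambda_2(P_{RS})\ \ge\ \frac{c}{d\log d}\min\Big\{1,\frac{C^2}{M^{2q/\beta}(d\log d)^{2q/\beta}}\Big\},$$ and, whenever $\mu$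 is an $\Omega$-warm start ($\mu(S)\le\Omega\,\pi(S)$ for all measurable $S$) and $0<\zeta\le\sqrt\Omega$, $$\tau(\zeta,P_{RS})\ \le\ K\,d\log d\cdot\max\Big\{1,\frac{M^{2q/\beta}(d\log d)^{2q/\beta}}{C^2}\Big\}\cdot\log\Big(\frac{\sqrt\Omega}{\zeta}\Big).$$ For $d\ge3$ the constants $c,K$ are universal (they depend on nothing: not on $d,q,\beta,M,C,\pi,\mu,\Omega,\zeta$); for $d=2$ they depend on $q$ only. -/

import Mathlib

open MeasureTheory ProbabilityTheory Filter Topology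
open scoped ENNReal NNReal

noncomputable section

namespace Gibbs

/-- The state space `ℝ^d` with the Euclidean norm. -/
abbrev E (d : ℕ) : Type := EuclideanSpace ℝ (Fin d)

/-- The space `ℝ^{d-1}` of the coordinates other than the `k`-th, with the Euclidean norm. -/
abbrev ECompl {d : ℕ} (k : Fin d) : Type := EuclideanSpace ℝ {j : Fin d // j ≠ k}

/-- `x ↦ x_{-k}`: forget the `k`-th coordinate. -/
def dropCoord {d : ℕ} (k : Fin d) (x : E d) : ECompl k :=
  WithLp.toLp 2 (fun j => x j.1)

/-- `(x, t) ↦ (x_{-k}, t)`: replace the `k`-th coordinate of `x` by `t`. -/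
def setCoord {d : ℕ} (k : Fin d) (x : E d) (t : ℝ) : E d :=
  WithLp.toLp 2 (Function.update (WithLp.ofLp x) k t)

theorem measurable_dropCoord {d : ℕ} (k : Fin d) : Measurable (dropCoord k) := by
  unfold dropCoord
  fun_prop

theorem measurable_setCoord {d : ℕ} (k : Fin d) :
    Measurable (fun p : E d × ℝ => setCoord k p.1 p.2) := by
  unfold setCoord
  refine (WithLp.measurable_toLp 2 _).comp (measurable_pi_lambda _ fun j => ?_)
  by_cases h : j = k
  · subst h
    simpa using measurable_snd
  · simp only [Function.update_of_ne h]
    fun_prop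

/-- Total variation distance `sup_S |μ(S) - ν(S)|` over the measurable sets `S`. -/
def tvDist {X : Type*} [MeasurableSpace X] (μ ν : Measure X) : ℝ :=
  ⨆ S : {S : Set X // MeasurableSet S}, |μ.real S.1 - ν.real S.1|

/-- `f` is Lipschitz on every open ball. -/
def LipschitzOnBalls {d : ℕ} (f : E d → ℝ) : Prop :=
  ∀ (x : E d) (r : ℝ), ∃ K : ℝ≥0, LipschitzOnWith K f (Metric.ball x r)

/-- The modulus of the gradient of `f` at `x`,
`limsup_{y → x, y ≠ x} |f y - f x| / |y - x|`. It is the norm of the derivative at every point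
where `f` is differentiable (see `modGrad_eq`), hence Lebesgue-almost everywhere when `f` is
locally Lipschitz; the `limsup` gives it a meaning at the remaining points, which a
distribution without a density may charge. -/
def modGrad {d : ℕ} (f : E d → ℝ) (x : E d) : ℝ≥0∞ :=
  limsup (fun y => edist (f y) (f x) / edist y x) (𝓝[≠] x)

theorem modGrad_eq {d : ℕ} {f : E d → ℝ} {x : E d} (hf : DifferentiableAt ℝ f x) :
    modGrad f x = ‖fderiv ℝ f x‖ₑ := by
  have hL := hf.hasFDerivAt
  set L := fderiv ℝ f x
  have hlim := hasFDerivAt_iff_isLittleO.1 hL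
  apply le_antisymm
  · refine ENNReal.le_of_forall_pos_le_add fun ε hε _ => ?_
    refine limsup_le_of_le (by isBoundedDefault) ?_
    have h1 := (hlim.def (c := (ε : ℝ)) (by exact_mod_cast hε)).filter_mono
      (nhdsWithin_le_nhds (s := {x}ᶜ))
    filter_upwards [h1] with y hy
    refine ENNReal.div_le_of_le_mul ?_
    have h2 : ‖f y - f x‖ ≤ (‖L‖ + ε) * ‖y - x‖ := by
      have h3 := L.le_opNorm (y - x)
      have h4 : f y - f x = (f y - f x - L (y - x)) + L (y - x) := by ring
      calc ‖f y - f x‖ ≤ ‖f y - f x - L (y - x)‖ + ‖L (y - x)‖ := by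
            conv_lhs => rw [h4]
            exact norm_add_le _ _
        _ ≤ _ := by linarith
    rw [edist_eq_enorm_sub, edist_eq_enorm_sub]
    have h5 : ‖f y - f x‖₊ ≤ (‖L‖₊ + ε) * ‖y - x‖₊ := by exact_mod_cast h2
    simp only [enorm]
    exact_mod_cast h5
  · by_contra hlt
    push Not at hlt
    obtain ⟨b, hb1, hb2⟩ := ENNReal.lt_iff_exists_nnreal_btwn.1 hlt
    have hb2' : (b : ℝ) < ‖L‖ := by
      simp only [enorm] at hb2
      exact_mod_cast hb2
    have hev : ∀ᶠ y in 𝓝[≠] x, ‖f y - f x‖ ≤ b * ‖y - x‖ := by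
      filter_upwards [eventually_lt_of_limsup_lt hb1, self_mem_nhdsWithin] with y hy hne
      have hne' : edist y x ≠ 0 := by simpa [edist_eq_zero] using hne
      have h6 := (ENNReal.div_le_iff hne' (edist_ne_top y x)).1 hy.le
      rw [edist_eq_enorm_sub, edist_eq_enorm_sub] at h6
      simp only [enorm] at h6
      have h7 : ‖f y - f x‖₊ ≤ b * ‖y - x‖₊ := by exact_mod_cast h6
      exact_mod_cast h7
    have hev' : ∀ᶠ y in 𝓝 x, ‖f y - f x‖ ≤ b * ‖y - x‖ := by
      filter_upwards [eventually_nhdsWithin_iff.1 hev] with y hy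
      by_cases h : y = x
      · simp [h]
      · exact hy h
    exact absurd (hL.le_of_lip' b.2 hev') (not_le.2 hb2')

/-- The `L^q`-Poincaré inequality with constant `C`:
`𝔼 |f - 𝔼 f|^q ≤ C⁻¹ 𝔼 |∇f|^q` for all locally Lipschitz `f` (with a finite mean). -/
def PoincareIneq {d : ℕ} (π : Measure (E d)) (q C : ℝ) : Prop :=
  ∀ f : E d → ℝ, LipschitzOnBalls f → Integrable f π →
    ∫⁻ x, (ENNReal.ofReal |f x - ∫ y, f y ∂π|) ^ q ∂π
      ≤ (ENNReal.ofReal C)⁻¹ * ∫⁻ x, modGrad f x ^ q ∂π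

/-- `κ` is a version of the conditional distribution of `X_k` given `X_{-k}`, where `X ∼ π`. -/
def IsConditional {d : ℕ} (π : Measure (E d)) (k : Fin d) (κ : Kernel (ECompl k) ℝ) : Prop :=
  π.map (fun x => (dropCoord k x, x k)) = (π.map (dropCoord k)) ⊗ₘ κ

/-- `(M, β)`-TV continuity of the conditional distributions `κ k = π(· | x_{-k})`. -/
def TVContinuous {d : ℕ} (κ : (k : Fin d) → Kernel (ECompl k) ℝ) (M β : ℝ) : Prop :=
  ∀ (k : Fin d) (x y : E d),
    tvDist (κ k (dropCoord k x)) (κ k (dropCoord k y)) ≤ M * ‖dropCoord k x - dropCoord k y‖ ^ β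

/-- The kernel `P_k`: resample the `k`-th coordinate from its conditional distribution and keep
the other coordinates. -/
def coordKernel {d : ℕ} (k : Fin d) (κ : Kernel (ECompl k) ℝ) [IsMarkovKernel κ] :
    Kernel (E d) (E d) where
  toFun x := (κ (dropCoord k x)).map (setCoord k x)
  measurable' := by
    refine Measure.measurable_of_measurable_coe _ fun S hS => ?_
    have h : ∀ x : E d, (κ (dropCoord k x)).map (setCoord k x) S
        = (κ.comap (dropCoord k) (measurable_dropCoord k)) x
            (Prod.mk x ⁻¹' ((fun p : E d × ℝ => setCoord k p.1 p.2) ⁻¹' S)) := by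
      intro x
      have hx : Measurable (setCoord k x) :=
        (measurable_setCoord k).comp measurable_prodMk_left
      rw [Measure.map_apply hx hS, Kernel.comap_apply]
      rfl
    simp_rw [h]
    exact Kernel.measurable_kernel_prodMk_left (measurable_setCoord k hS)

/-- The random-scan Gibbs kernel `P_RS = (1/d) ∑_k P_k`. -/
def randomScan {d : ℕ} (κ : (k : Fin d) → Kernel (ECompl k) ℝ) [∀ k, IsMarkovKernel (κ k)] :
    Kernel (E d) (E d) where
  toFun x := (d : ℝ≥0∞)⁻¹ • ∑ k, coordKernel k (κ k) x
  measurable' := by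
    refine Measure.measurable_of_measurable_coe _ fun S hS => ?_
    simp only [Measure.smul_apply, Measure.finsetSum_apply, smul_eq_mul]
    exact (Finset.measurable_sum _ fun k _ => Kernel.measurable_coe _ hS).const_mul _

/-- The conductance of `P`: the infimum of `∫_S P(x, Sᶜ) π(dx) / π(S)` over the measurable sets
`S` with `0 < π(S) ≤ 1/2`. -/
def conductance {d : ℕ} (π : Measure (E d)) (P : Kernel (E d) (E d)) : ℝ≥0∞ :=
  ⨅ (S : Set (E d)) (_ : MeasurableSet S) (_ : 0 < π S) (_ : π S ≤ 1 / 2),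
    (∫⁻ x in S, P x Sᶜ ∂π) / π S

/-- The spectral gap of `P`: the infimum of `⟨f, (I - P) f⟩ / ‖f‖₂²` over the non-zero
`f ∈ L²(π)` of mean zero. -/
def spectralGap {d : ℕ} (π : Measure (E d)) (P : Kernel (E d) (E d)) : EReal :=
  ⨅ (f : E d → ℝ) (_ : MemLp f 2 π) (_ : ∫ x, f x ∂π = 0) (_ : ∫ x, f x ^ 2 ∂π ≠ 0),
    (((∫ x, f x * (f x - ∫ y, f y ∂(P x)) ∂π) / ∫ x, f x ^ 2 ∂π : ℝ) : EReal)

/-- `μ` is an `Ω`-warm start for `π`: `μ(S) / π(S) ≤ Ω` for all measurable `S`. -/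
def WarmStart {d : ℕ} (μ π : Measure (E d)) (Ω : ℝ) : Prop :=
  ∀ S : Set (E d), MeasurableSet S → μ S ≤ ENNReal.ofReal Ω * π S

/-- The law `μ P^n` after `n` steps of the chain started from `μ`. -/
def stepLaw {d : ℕ} (μ : Measure (E d)) (P : Kernel (E d) (E d)) (n : ℕ) : Measure (E d) :=
  (fun ν => ν.bind P)^[n] μ

/-- The `ζ`-mixing time from the initial law `μ`: the least `n` with `‖μ P^n - π‖_TV ≤ ζ`, and
`∞` if there is none. -/
def mixingTime {d : ℕ} (μ π : Measure (E d)) (P : Kernel (E d) (E d)) (ζ : ℝ) : ℕ∞ :=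
  ⨅ (n : ℕ) (_ : tvDist (stepLaw μ P n) π ≤ ζ), (n : ℕ∞)

/-- The three bounds for the random-scan Gibbs kernel on `ℝ^d`, with implied constants `c` (in
the two lower bounds) and `K` (in the upper bound), for all targets satisfying an `L^q`-Poincaré
inequality with `(M, β)`-TV continuous conditional distributions. -/
def RandomScanBounds (d : ℕ) (q c K : ℝ) : Prop :=
  ∀ (β M C : ℝ), 0 < β → β ≤ 1 → 0 < M → 0 < C →
  ∀ (π : Measure (E d)) [IsProbabilityMeasure π]
    (κ : (k : Fin d) → Kernel (ECompl k) ℝ) [∀ k, IsMarkovKernel (κ k)],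
    (∀ k, IsConditional π k (κ k)) → TVContinuous κ M β → PoincareIneq π q C →
    ENNReal.ofReal (c * (1 / (d * Real.log d)
        * min 1 (C / (M ^ (q / β) * (d * Real.log d) ^ (q / β)))))
      ≤ conductance π (randomScan κ) ∧
    ((c * (1 / (d * Real.log d)
        * min 1 (C ^ 2 / (M ^ (2 * q / β) * (d * Real.log d) ^ (2 * q / β)))) : ℝ) : EReal)
      ≤ spectralGap π (randomScan κ) ∧
    ∀ (μ : Measure (E d)) [IsProbabilityMeasure μ] (Ω ζ : ℝ),
      WarmStart μ π Ω → 0 < ζ → ζ ≤ √Ω →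
      ((mixingTime μ π (randomScan κ) ζ : ℕ∞) : ℝ≥0∞)
        ≤ ENNReal.ofReal (K * (d * Real.log d
          * max 1 (M ^ (2 * q / β) * (d * Real.log d) ^ (2 * q / β) / C ^ 2)
          * Real.log (√Ω / ζ)))

end Gibbs

end

/-! Write `P` for `randomScan κ` and `Λ = d log d`. One step of `P` moves a single coordinate, so
laws started at nearby points need not overlap. The argument therefore studies `P ^ n` with `n =
⌈2Λ⌉`, a coupon-collector time, and transfers the estimates back to `P`.

Overlap. Run two copies from points at distance at most `Δ`, of order `(MΛ) ^ (-1/β)`, updating the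
same coordinate in both. By TV continuity an update fails to give both copies the same new value
with probability at most `θ`, of order `1/Λ`, and a success never increases the distance. All `n`
updates succeed and all coordinates are visited with probability bounded below, so the laws of `P ^
n` overlap by a universal amount (`avg_randomScan_pow_sub_le`, `overlap_lower_bound`).

Conductance. The Poincaré inequality applied to a ramp between two separated sets gives a three-set
isoperimetric inequality (`isoperimetry`). With the overlap it bounds the conductance of `P ^ n`
below by `φ`, of order `min 1 (C Δ ^ q)` (`flow_ge_of_overlap`). Since `flow π (P ^ n) S ≤ n * flow
π P S` (`flow_pow_le`), the conductance of `P` is at least `φ / n`.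

Gap and mixing. Cheeger's inequality (`cheeger`) is applied to `P ^ n`, not to `P`. As an average of
orthogonal projections, `P` is self-adjoint with spectrum in `[0, 1]`, so `⟨f, (1 - P ^ n) f⟩ ≤ n
⟨f, (1 - P) f⟩` (`form_sub_pow_le`). The gap of `P` is then at least `φ² / (2n)`, better by a factor
of order `n` than Cheeger for `P` itself. Positivity and the gap make the variance of `P ^ n 1_S`
decay geometrically, which bounds the mixing time from a warm start (`mixingTime_le`). -/

namespace Gibbs

/-! ### Powers of a positive self-adjoint contraction. -/

section Abstract

variable {V : Type*} [AddCommGroup V] [Module ℝ V] (B : V →ₗ[ℝ] V →ₗ[ℝ] ℝ) (T : V →ₗ[ℝ] V)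

theorem form_pow_symm (hsymm : ∀ f g, B (T f) g = B f (T g)) (n : ℕ) (f g : V) :
    B ((T ^ n) f) g = B f ((T ^ n) g) := by
  induction n generalizing f g with
  | zero => simp
  | succ n ih => rw [pow_succ, Module.End.mul_apply, ih, hsymm, ← Module.End.mul_apply, ← pow_succ',
      pow_succ]

/-- For symmetric `T`, `hpos` says `T² ≤ T`, the algebraic form of having spectrum in `[0, 1]`. An
even power pairs to a square; an odd one is `⟨g, T g⟩ ≥ ⟨T g, T g⟩` with `g = T ^ m f`. -/
theorem form_pow_nonneg (hB : ∀ f, 0 ≤ B f f) (hsymm : ∀ f g, B (T f) g = B f (T g))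
    (hpos : ∀ f, B (T f) (T f) ≤ B f (T f)) (n : ℕ) (f : V) : 0 ≤ B f ((T ^ n) f) := by
  obtain ⟨m, rfl | rfl⟩ := Nat.even_or_odd' n
  · rw [two_mul, pow_add, Module.End.mul_apply, ← form_pow_symm B T hsymm]
    exact hB _
  · have h : (T ^ (2 * m + 1)) f = (T ^ m) (T ((T ^ m) f)) := by
      simp only [← Module.End.mul_apply]
      congr 1
      rw [two_mul, pow_succ, pow_add, mul_assoc, ← pow_succ, pow_succ']
    rw [h, ← form_pow_symm B T hsymm]
    exact (hB _).trans (hpos _)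

/-- For a positive self-adjoint contraction `T`, `⟨f, (1 - T ^ n) f⟩ ≤ n ⟨f, (1 - T) f⟩`. -/
theorem form_sub_pow_le (hB : ∀ f, 0 ≤ B f f) (hsymm : ∀ f g, B (T f) g = B f (T g))
    (hpos : ∀ f, B (T f) (T f) ≤ B f (T f)) (n : ℕ) (f : V) :
    B f f - B f ((T ^ n) f) ≤ n * (B f f - B f (T f)) := by
  -- The sequence `⟨f, T ^ j f⟩` is convex: its second difference is `⟨g, T ^ j g⟩ ≥ 0` with `g = f
  -- - T f`. Hence no decrement exceeds the first one.
  have hconv : ∀ j, B f ((T ^ (j + 1)) f) - B f ((T ^ (j + 2)) f)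
      ≤ B f ((T ^ j) f) - B f ((T ^ (j + 1)) f) := by
    intro j
    have h := form_pow_nonneg B T hB hsymm hpos j (f - T f)
    have h1 : (T ^ j) (T f) = (T ^ (j + 1)) f := by rw [pow_succ, Module.End.mul_apply]
    have h2 : T ((T ^ j) f) = (T ^ (j + 1)) f := by rw [pow_succ', Module.End.mul_apply]
    have h3 : T ((T ^ (j + 1)) f) = (T ^ (j + 2)) f := by
      rw [pow_succ' T (j + 1), Module.End.mul_apply]
    simp only [map_sub, LinearMap.sub_apply, h1, hsymm, h2, h3] at h
    linarith
  have hstep : ∀ j, B f ((T ^ j) f) - B f ((T ^ (j + 1)) f) ≤ B f f - B f (T f) := by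
    intro j
    induction j with
    | zero => simp
    | succ j ih => exact (hconv j).trans ih
  induction n with
  | zero => simp
  | succ n ih =>
    have := hstep n
    push_cast
    linarith

end Abstract

/-! ### Markov kernels as operators on bounded functions, and their Dirichlet forms. -/

section Generic

variable {X : Type*} [MeasurableSpace X]

/-- The bounded measurable real functions on `X`. -/
def boundedMeasurable (X : Type*) [MeasurableSpace X] : Submodule ℝ (X → ℝ) where
  carrier := {f | Measurable f ∧ ∃ C, ∀ x, |f x| ≤ C}
  add_mem' := by
    rintro f g ⟨hf, C, hC⟩ ⟨hg, D, hD⟩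
    exact ⟨hf.add hg, C + D, fun x => (abs_add_le _ _).trans (add_le_add (hC x) (hD x))⟩
  zero_mem' := ⟨measurable_const, 0, by simp⟩
  smul_mem' := by
    rintro c f ⟨hf, C, hC⟩
    refine ⟨hf.const_smul c, |c| * C, fun x => ?_⟩
    rw [Pi.smul_apply, smul_eq_mul, abs_mul]
    exact mul_le_mul_of_nonneg_left (hC x) (abs_nonneg c)

theorem integrable_of_bounded {f : X → ℝ} (hf : f ∈ boundedMeasurable X) (μ : Measure X)
    [IsFiniteMeasure μ] : Integrable f μ := by
  obtain ⟨hm, C, hC⟩ := hf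
  exact Integrable.of_bound hm.aestronglyMeasurable C (ae_of_all _ hC)

theorem mul_mem_boundedMeasurable {f g : X → ℝ} (hf : f ∈ boundedMeasurable X)
    (hg : g ∈ boundedMeasurable X) : (fun x => f x * g x) ∈ boundedMeasurable X := by
  obtain ⟨hf, C, hC⟩ := hf
  obtain ⟨hg, D, hD⟩ := hg
  refine ⟨hf.mul hg, C * D, fun x => ?_⟩
  rw [abs_mul]
  exact mul_le_mul (hC x) (hD x) (abs_nonneg _) ((abs_nonneg _).trans (hC x))

theorem const_mem_boundedMeasurable (c : ℝ) : (fun _ => c) ∈ boundedMeasurable X :=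
  ⟨measurable_const, |c|, fun _ => le_rfl⟩

theorem comp_mem_boundedMeasurable {Y : Type*} [MeasurableSpace Y] {f : X → ℝ}
    (hf : f ∈ boundedMeasurable X) {u : Y → X} (hu : Measurable u) :
    (fun y => f (u y)) ∈ boundedMeasurable Y :=
  ⟨hf.1.comp hu, hf.2.imp fun _ h y => h (u y)⟩

theorem mem_boundedMeasurable_of_mem_Icc {f : X → ℝ} (hf : Measurable f) {a : ℝ}
    (h : ∀ x, 0 ≤ f x ∧ f x ≤ a) : f ∈ boundedMeasurable X :=
  ⟨hf, a, fun x => by rw [abs_of_nonneg (h x).1]; exact (h x).2⟩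

/-- The averaging operator `f ↦ ∫ f dP(x, ·)` of a Markov kernel on bounded functions. -/
noncomputable def avg (P : Kernel X X) [IsMarkovKernel P] :
    boundedMeasurable X →ₗ[ℝ] boundedMeasurable X where
  toFun f := ⟨fun x => ∫ y, f.1 y ∂P x, by
    obtain ⟨hm, C, hC⟩ := f.2
    refine ⟨(hm.stronglyMeasurable.integral_kernel).measurable, C, fun x => ?_⟩
    have := norm_integral_le_of_norm_le_const (μ := P x) (f := f.1) (C := C) (ae_of_all _ hC)
    simpa using this⟩
  map_add' f g := by
    ext x
    exact integral_add (integrable_of_bounded f.2 _) (integrable_of_bounded g.2 _)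
  map_smul' c f := by
    ext x
    exact integral_const_mul c _

theorem avg_apply (P : Kernel X X) [IsMarkovKernel P] (f : boundedMeasurable X) (x : X) :
    (avg P f).1 x = ∫ y, f.1 y ∂P x := rfl

instance isMarkovKernel_pow (P : Kernel X X) [IsMarkovKernel P] (n : ℕ) :
    IsMarkovKernel (P ^ n) := by
  induction n with
  | zero => rw [pow_zero]; exact (inferInstance : IsMarkovKernel Kernel.id)
  | succ n ih => rw [pow_succ]; exact (inferInstance : IsMarkovKernel ((P ^ n) ∘ₖ P))

theorem kernel_pow_succ (P : Kernel X X) (n : ℕ) : P ^ (n + 1) = (P ^ n) ∘ₖ P := pow_succ P n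

theorem kernel_pow_succ' (P : Kernel X X) (n : ℕ) : P ^ (n + 1) = P ∘ₖ (P ^ n) := pow_succ' P n

theorem avg_pow (P : Kernel X X) [IsMarkovKernel P] (n : ℕ) : avg (P ^ n) = avg P ^ n := by
  induction n with
  | zero =>
    ext f x
    rw [avg_apply]
    simp only [pow_zero]
    change ∫ y, f.1 y ∂(Kernel.id x) = f.1 x
    rw [Kernel.id_apply]
    exact integral_dirac' _ _ f.2.1.stronglyMeasurable
  | succ n ih =>
    ext f x
    rw [pow_succ' (avg P), Module.End.mul_apply, ← ih, avg_apply, avg_apply]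
    simp only [avg_apply]
    have : IsMarkovKernel ((P ^ n) ∘ₖ P) := inferInstance
    rw [kernel_pow_succ, Kernel.integral_comp (integrable_of_bounded f.2 _)]

theorem invariant_pow {P : Kernel X X} {π : Measure X} (h : P.Invariant π) (n : ℕ) :
    (P ^ n).Invariant π := by
  induction n with
  | zero => exact Measure.id_comp
  | succ n ih => rw [kernel_pow_succ]; exact ih.comp h

/-- The inner product of `L²(π)` on bounded functions. -/
noncomputable def form (π : Measure X) [IsProbabilityMeasure π] :
    boundedMeasurable X →ₗ[ℝ] boundedMeasurable X →ₗ[ℝ] ℝ :=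
  LinearMap.mk₂ ℝ (fun f g => ∫ x, f.1 x * g.1 x ∂π)
    (fun f g h => by
      rw [← integral_add (integrable_of_bounded (mul_mem_boundedMeasurable f.2 h.2) _)
        (integrable_of_bounded (mul_mem_boundedMeasurable g.2 h.2) _)]
      simp [add_mul])
    (fun c f g => by
      rw [smul_eq_mul, ← integral_const_mul]
      simp [mul_assoc])
    (fun f g h => by
      rw [← integral_add (integrable_of_bounded (mul_mem_boundedMeasurable f.2 g.2) _)
        (integrable_of_bounded (mul_mem_boundedMeasurable f.2 h.2) _)]
      simp [mul_add])
    (fun c f g => by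
      rw [smul_eq_mul, ← integral_const_mul]
      simp [mul_left_comm])

theorem form_apply (π : Measure X) [IsProbabilityMeasure π] (f g : boundedMeasurable X) :
    form π f g = ∫ x, f.1 x * g.1 x ∂π := rfl

theorem measurePreserving_fst_compProd (π : Measure X) [IsProbabilityMeasure π] (P : Kernel X X)
    [IsMarkovKernel P] : MeasurePreserving Prod.fst (π ⊗ₘ P) π :=
  ⟨measurable_fst, Measure.fst_compProd π P⟩

theorem measurePreserving_snd_compProd {π : Measure X} [IsProbabilityMeasure π] {P : Kernel X X}
    [IsMarkovKernel P] (h : P.Invariant π) : MeasurePreserving Prod.snd (π ⊗ₘ P) π :=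
  ⟨measurable_snd, by rw [← Measure.snd, Measure.snd_compProd, h.def]⟩

theorem integral_comp_of_measurePreserving {Y : Type*} [MeasurableSpace Y] {ρ : Measure Y}
    {π : Measure X} {u : Y → X} (hu : MeasurePreserving u ρ π) {f : X → ℝ}
    (hf : AEStronglyMeasurable f π) : ∫ y, f (u y) ∂ρ = ∫ x, f x ∂π := by
  rw [← hu.map_eq, integral_map hu.measurable.aemeasurable (by rwa [hu.map_eq])]

theorem integral_avg {P : Kernel X X} [IsMarkovKernel P] {π : Measure X} [IsProbabilityMeasure π]
    (h : P.Invariant π) (f : boundedMeasurable X) : ∫ x, (avg P f).1 x ∂π = ∫ x, f.1 x ∂π := by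
  have hi := integrable_of_bounded (comp_mem_boundedMeasurable f.2 measurable_snd) (π ⊗ₘ P)
  have m2 := measurePreserving_snd_compProd h
  calc ∫ x, (avg P f).1 x ∂π = ∫ p, f.1 p.2 ∂(π ⊗ₘ P) := (Measure.integral_compProd hi).symm
    _ = ∫ x, f.1 x ∂π := integral_comp_of_measurePreserving m2 f.2.1.aestronglyMeasurable

/-- The Dirichlet form of an invariant kernel on `L²`. -/
theorem integral_sub_sq_eq {π : Measure X} [IsProbabilityMeasure π] {P : Kernel X X}
    [IsMarkovKernel P] (h : P.Invariant π) {f : X → ℝ} (hf : MemLp f 2 π) :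
    Integrable (fun p : X × X => (f p.1 - f p.2) ^ 2) (π ⊗ₘ P) ∧
    ∫ x, f x * (f x - ∫ y, f y ∂(P x)) ∂π
      = (1 / 2) * ∫ p, (f p.1 - f p.2) ^ 2 ∂(π ⊗ₘ P) := by
  have m1 := measurePreserving_fst_compProd π P
  -- Invariance makes the second marginal of a stationary step equal to `π`; this symmetry of
  -- marginals replaces reversibility in the identity.
  have m2 := measurePreserving_snd_compProd h
  have h1 : MemLp (fun p : X × X => f p.1) 2 (π ⊗ₘ P) := hf.comp_measurePreserving m1
  have h2 : MemLp (fun p : X × X => f p.2) 2 (π ⊗ₘ P) := hf.comp_measurePreserving m2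
  have i1 := h1.integrable_sq
  have i2 := h2.integrable_sq
  have i12 : Integrable (fun p : X × X => f p.1 * f p.2) (π ⊗ₘ P) := h1.integrable_mul h2
  have e1 : ∫ p, f p.1 ^ 2 ∂(π ⊗ₘ P) = ∫ x, f x ^ 2 ∂π :=
    integral_comp_of_measurePreserving m1 (hf.aestronglyMeasurable.pow 2)
  have e2 : ∫ p, f p.2 ^ 2 ∂(π ⊗ₘ P) = ∫ x, f x ^ 2 ∂π :=
    integral_comp_of_measurePreserving m2 (hf.aestronglyMeasurable.pow 2)
  have e12 : ∫ p, f p.1 * f p.2 ∂(π ⊗ₘ P) = ∫ x, f x * ∫ y, f y ∂(P x) ∂π := by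
    rw [Measure.integral_compProd i12]
    simp only [integral_const_mul]
  have i3 : Integrable (fun x => f x * ∫ y, f y ∂(P x)) π := by
    have := Integrable.integral_compProd (κ := Kernel.const Unit π)
      (η := Kernel.prodMkLeft Unit P) (a := ()) i12
    simpa only [integral_const_mul, Kernel.const_apply, Kernel.prodMkLeft_apply] using this
  have hexp : (fun p : X × X => (f p.1 - f p.2) ^ 2)
      = fun p => f p.1 ^ 2 + f p.2 ^ 2 - 2 * (f p.1 * f p.2) := by
    ext p; ring
  refine ⟨(h1.sub h2).integrable_sq, ?_⟩
  rw [hexp, integral_sub (by exact i1.add i2) (i12.const_mul 2), integral_add i1 i2, integral_const_mul,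
    e1, e2, e12]
  have : (fun x => f x * (f x - ∫ y, f y ∂(P x)))
      = fun x => f x ^ 2 - f x * ∫ y, f y ∂(P x) := by ext x; ring
  rw [this, integral_sub hf.integrable_sq i3]
  ring

end Generic

/-! ### Conductance, its behaviour under powers, and Cheeger's inequality. -/

section Conductance

variable {X : Type*} [MeasurableSpace X]

/-- The probability that a stationary step of `P` starts in `S` and ends outside `S`. -/
noncomputable def flow (π : Measure X) (P : Kernel X X) (S : Set X) : ℝ≥0∞ :=
  ∫⁻ x in S, P x Sᶜ ∂π

theorem lintegral_kernel {P : Kernel X X} {π : Measure X} (h : P.Invariant π) {f : X → ℝ≥0∞}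
    (hf : Measurable f) : ∫⁻ x, ∫⁻ y, f y ∂P x ∂π = ∫⁻ x, f x ∂π := by
  conv_rhs => rw [← h.def]
  exact (Measure.lintegral_bind P.aemeasurable hf.aemeasurable).symm

theorem flow_eq_compProd {P : Kernel X X} [IsMarkovKernel P] {π : Measure X}
    [IsProbabilityMeasure π] {S : Set X} (hS : MeasurableSet S) :
    flow π P S = (π ⊗ₘ P) (S ×ˢ Sᶜ) := by
  rw [Measure.compProd_apply_prod hS hS.compl, flow]

theorem flow_add_compProd {P : Kernel X X} [IsMarkovKernel P] {π : Measure X}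
    [IsProbabilityMeasure π] {S : Set X} (hS : MeasurableSet S) :
    flow π P S + (π ⊗ₘ P) (S ×ˢ S) = π S := by
  rw [flow, Measure.compProd_apply_prod hS hS, ← lintegral_add_left (P.measurable_coe hS.compl)]
  have : ∀ x, P x Sᶜ + P x S = 1 := fun x => by
    rw [add_comm, measure_add_measure_compl hS, measure_univ]
  simp [this]

/-- Both coordinates of a stationary step have law `π`, so crossings in either direction have mass
`π S` minus the mass of `S ×ˢ S`. -/
theorem flow_compl {P : Kernel X X} [IsMarkovKernel P] {π : Measure X} [IsProbabilityMeasure π]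
    (h : P.Invariant π) {S : Set X} (hS : MeasurableSet S) : flow π P Sᶜ = flow π P S := by
  have h1 := flow_add_compProd (P := P) (π := π) hS
  have h2 : (π ⊗ₘ P) (Sᶜ ×ˢ S) + (π ⊗ₘ P) (S ×ˢ S) = π S := by
    rw [← measure_union (by
      rw [Set.disjoint_left]; rintro ⟨a, b⟩ h1 h2; exact h1.1 h2.1) (hS.prod hS), ← Set.union_prod,
      Set.compl_union_self, ← (measurePreserving_snd_compProd h).measure_preimage
        hS.nullMeasurableSet]
    congr 1
    ext p
    simp
  rw [← h1, ← compl_compl S, compl_compl Sᶜ, ← flow_eq_compProd hS.compl, compl_compl] at h2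
  exact WithTop.add_right_cancel (measure_ne_top _ _) h2

/-- A path from `S` that is outside at time `n + 1` is either outside at time `n`, or in `S` then
and jumps out at the last step. By stationarity the second event has probability at most `flow π P
S`. -/
theorem flow_pow_le {P : Kernel X X} [IsMarkovKernel P] {π : Measure X} [IsProbabilityMeasure π]
    (h : P.Invariant π) {S : Set X} (hS : MeasurableSet S) (n : ℕ) :
    flow π (P ^ n) S ≤ n * flow π P S := by
  induction n with
  | zero =>
    have : flow π (P ^ 0) S = 0 := by
      rw [flow, pow_zero]
      change ∫⁻ x in S, (Kernel.id x) Sᶜ ∂π = 0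
      rw [setLIntegral_congr_fun (g := fun _ => 0) hS]
      · simp
      · intro x hx
        simp [Kernel.id_apply, Measure.dirac_apply' _ hS.compl, hx]
    simpa using this.le
  | succ n ih =>
    have hm : Measurable fun y => P y Sᶜ := P.measurable_coe hS.compl
    have hpt : ∀ x, (P ^ (n + 1)) x Sᶜ ≤ (P ^ n) x Sᶜ
        + ∫⁻ y, S.indicator (fun y => P y Sᶜ) y ∂((P ^ n) x) := by
      intro x
      rw [kernel_pow_succ', Kernel.comp_apply' _ _ _ hS.compl, ← lintegral_indicator_one hS.compl,
        ← lintegral_add_left (measurable_one.indicator hS.compl)]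
      refine lintegral_mono fun y => ?_
      by_cases hy : y ∈ S
      · simp [hy]
      · simpa [hy] using prob_le_one
    calc flow π (P ^ (n + 1)) S
        ≤ ∫⁻ x in S, ((P ^ n) x Sᶜ + ∫⁻ y, S.indicator (fun y => P y Sᶜ) y ∂((P ^ n) x)) ∂π :=
          lintegral_mono hpt
      _ = flow π (P ^ n) S + ∫⁻ x in S, ∫⁻ y, S.indicator (fun y => P y Sᶜ) y ∂((P ^ n) x) ∂π :=
          lintegral_add_left ((P ^ n).measurable_coe hS.compl) _
      _ ≤ n * flow π P S + ∫⁻ x, ∫⁻ y, S.indicator (fun y => P y Sᶜ) y ∂((P ^ n) x) ∂π :=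
          add_le_add ih (setLIntegral_le_lintegral _ _)
      _ = (n + 1 : ℕ) * flow π P S := by
          rw [lintegral_kernel (invariant_pow h n) (hm.indicator hS), lintegral_indicator hS]
          push_cast
          rw [add_mul, one_mul, flow]

/-- Coarea inequality for non-negative functions supported on a set of measure at most `1/2`. -/
theorem coarea_flow {P : Kernel X X} [IsMarkovKernel P] {π : Measure X} [IsProbabilityMeasure π]
    {φ : ℝ} (hφ : 0 ≤ φ)
    (hflow : ∀ S, MeasurableSet S → π S ≤ 1 / 2 → ENNReal.ofReal φ * π S ≤ flow π P S)
    {u : X → ℝ} (hu : u ∈ boundedMeasurable X) (hu0 : ∀ x, 0 ≤ u x) (hsupp : π {x | 0 < u x} ≤ 1 / 2) :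
    φ * ∫ x, u x ∂π + ∫ p, min (u p.1) (u p.2) ∂(π ⊗ₘ P) ≤ ∫ x, u x ∂π := by
  have hum := hu.1
  have hmin : (fun p : X × X => min (u p.1) (u p.2)) ∈ boundedMeasurable (X × X) := by
    obtain ⟨-, C, hC⟩ := hu
    refine mem_boundedMeasurable_of_mem_Icc (a := C)
      ((hum.comp measurable_fst).min (hum.comp measurable_snd)) fun p => ?_
    exact ⟨le_min (hu0 _) (hu0 _), (min_le_left _ _).trans ((le_abs_self _).trans (hC _))⟩
  have key : ENNReal.ofReal φ * ∫⁻ x, ENNReal.ofReal (u x) ∂π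
      + ∫⁻ p, ENNReal.ofReal (min (u p.1) (u p.2)) ∂(π ⊗ₘ P) ≤ ∫⁻ x, ENNReal.ofReal (u x) ∂π := by
    -- Layer cake on both sides: the level sets of `min (u p.1) (u p.2)` are the squares `S ×ˢ S` of
    -- the level sets of `u`, so each level is the identity `flow_add_compProd`.
    rw [lintegral_eq_lintegral_meas_lt π (ae_of_all _ hu0) hum.aemeasurable,
      lintegral_eq_lintegral_meas_lt (π ⊗ₘ P)
        (ae_of_all _ fun p : X × X => le_min (hu0 p.1) (hu0 p.2)) hmin.1.aemeasurable]
    refine (add_le_add_left (lintegral_const_mul_le _ _) _).trans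
      ((le_lintegral_add _ _).trans (setLIntegral_mono' measurableSet_Ioi fun t ht => ?_))
    have hS : MeasurableSet {x | t < u x} := measurableSet_lt measurable_const hum
    have hle : π {x | t < u x} ≤ 1 / 2 :=
      (measure_mono fun x hx => (lt_trans ht hx : 0 < u x)).trans hsupp
    have hset : {p : X × X | t < min (u p.1) (u p.2)} = {x | t < u x} ×ˢ {x | t < u x} := by
      ext p
      simp
    change ENNReal.ofReal φ * π {x | t < u x} + (π ⊗ₘ P) {p : X × X | t < min (u p.1) (u p.2)} ≤ _
    rw [hset]
    refine le_of_le_of_eq ?_ (flow_add_compProd (P := P) (π := π) hS)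
    exact add_le_add_left (hflow _ hS hle) _
  rw [← ofReal_integral_eq_lintegral_ofReal (integrable_of_bounded hu π) (ae_of_all _ hu0),
    ← ofReal_integral_eq_lintegral_ofReal (integrable_of_bounded hmin _)
      (ae_of_all _ fun p : X × X => le_min (hu0 p.1) (hu0 p.2)), ← ENNReal.ofReal_mul hφ,
    ← ENNReal.ofReal_add (mul_nonneg hφ (integral_nonneg hu0))
      (integral_nonneg fun p : X × X => le_min (hu0 p.1) (hu0 p.2)),
    ENNReal.ofReal_le_ofReal_iff (integral_nonneg hu0)] at key
  exact key

/-- Cheeger's inequality for non-negative functions supported on a set of measure at most `1/2`. -/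
theorem cheeger_of_nonneg {P : Kernel X X} [IsMarkovKernel P] {π : Measure X}
    [IsProbabilityMeasure π] (h : P.Invariant π) {φ : ℝ} (hφ : 0 < φ)
    (hflow : ∀ S, MeasurableSet S → π S ≤ 1 / 2 → ENNReal.ofReal φ * π S ≤ flow π P S)
    {g : X → ℝ} (hg : g ∈ boundedMeasurable X) (hg0 : ∀ x, 0 ≤ g x)
    (hsupp : π {x | 0 < g x} ≤ 1 / 2) :
    φ ^ 2 * ∫ x, g x ^ 2 ∂π ≤ ∫ p, (g p.1 - g p.2) ^ 2 ∂(π ⊗ₘ P) := by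
  have m1 := measurePreserving_fst_compProd π P
  have m2 := measurePreserving_snd_compProd h
  have hsq : (fun x => g x ^ 2) ∈ boundedMeasurable X := by
    simpa only [sq] using mul_mem_boundedMeasurable hg hg
  have hset : {x | 0 < g x ^ 2} = {x | 0 < g x} := by
    ext x
    exact ⟨fun hx => (hg0 x).lt_of_ne fun h0 => by simp [← h0] at hx, fun hx => pow_pos (Set.mem_ofPred.1 hx) 2⟩
  have hco := coarea_flow hφ.le hflow hsq (fun x => sq_nonneg _) (by rwa [hset])
  have e1 : ∫ p, g p.1 ^ 2 ∂(π ⊗ₘ P) = ∫ x, g x ^ 2 ∂π :=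
    integral_comp_of_measurePreserving m1 hsq.1.aestronglyMeasurable
  have e2 : ∫ p, g p.2 ^ 2 ∂(π ⊗ₘ P) = ∫ x, g x ^ 2 ∂π :=
    integral_comp_of_measurePreserving m2 hsq.1.aestronglyMeasurable
  have i1 := integrable_of_bounded (comp_mem_boundedMeasurable hsq measurable_fst) (π ⊗ₘ P)
  have i2 := integrable_of_bounded (comp_mem_boundedMeasurable hsq measurable_snd) (π ⊗ₘ P)
  have hd : (fun p : X × X => g p.1 - g p.2) ∈ boundedMeasurable (X × X) :=
    Submodule.sub_mem _ (comp_mem_boundedMeasurable hg measurable_fst)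
      (comp_mem_boundedMeasurable hg measurable_snd)
  have i3 : Integrable (fun p : X × X => (g p.1 - g p.2) ^ 2) (π ⊗ₘ P) := by
    simpa only [sq] using integrable_of_bounded (mul_mem_boundedMeasurable hd hd) _
  have hmin : Integrable (fun p : X × X => min (g p.1 ^ 2) (g p.2 ^ 2)) (π ⊗ₘ P) := i1.inf i2
  -- As `min (a²) (b²) = (a² + b²)/2 - |a² - b²|/2`, this is Young's inequality for `|a - b| * (a +
  -- b)` with weight `φ`, in place of Cauchy–Schwarz. The weight leaves half of the `φ`-term of the
  -- coarea inequality after integration.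
  have hpt : ∀ p : X × X, (1 / 2 - φ / 4) * (g p.1 ^ 2 + g p.2 ^ 2)
      - (1 / (2 * φ)) * (g p.1 - g p.2) ^ 2 ≤ min (g p.1 ^ 2) (g p.2 ^ 2) := by
    intro p
    have hφ' : (1 / (2 * φ)) * φ = 1 / 2 := by field_simp
    have h1 : 0 ≤ (1 / (2 * φ)) * ((g p.1 - g p.2) - (φ / 2) * (g p.1 + g p.2)) ^ 2 := by
      positivity
    have h2 : 0 ≤ (1 / (2 * φ)) * ((g p.1 - g p.2) + (φ / 2) * (g p.1 + g p.2)) ^ 2 := by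
      positivity
    have e1 : (1 / (2 * φ)) * ((g p.1 - g p.2) - (φ / 2) * (g p.1 + g p.2)) ^ 2
        = (1 / (2 * φ)) * (g p.1 - g p.2) ^ 2 - (1 / 2) * (g p.1 ^ 2 - g p.2 ^ 2)
          + (φ / 8) * (g p.1 + g p.2) ^ 2 := by field_simp; ring
    have e2 : (1 / (2 * φ)) * ((g p.1 - g p.2) + (φ / 2) * (g p.1 + g p.2)) ^ 2
        = (1 / (2 * φ)) * (g p.1 - g p.2) ^ 2 + (1 / 2) * (g p.1 ^ 2 - g p.2 ^ 2)
          + (φ / 8) * (g p.1 + g p.2) ^ 2 := by field_simp; ring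
    rw [e1] at h1
    rw [e2] at h2
    have h3 : (φ / 8) * (g p.1 + g p.2) ^ 2 ≤ (φ / 4) * (g p.1 ^ 2 + g p.2 ^ 2) := by
      nlinarith [sq_nonneg (g p.1 - g p.2), mul_nonneg hφ.le (sq_nonneg (g p.1 - g p.2))]
    refine le_min ?_ ?_ <;> nlinarith
  have hint := integral_mono (((i1.add i2).const_mul _).sub (i3.const_mul _)) hmin hpt
  rw [integral_sub' ((i1.add i2).const_mul _) (i3.const_mul _), integral_const_mul,
    integral_const_mul, integral_add' i1 i2, e1, e2] at hint
  have hfin : (φ / 2) * ∫ x, g x ^ 2 ∂π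
      ≤ (1 / (2 * φ)) * ∫ p, (g p.1 - g p.2) ^ 2 ∂(π ⊗ₘ P) := by linarith
  have := mul_le_mul_of_nonneg_left hfin (by positivity : (0 : ℝ) ≤ 2 * φ)
  have e : 2 * φ * ((1 / (2 * φ)) * ∫ p, (g p.1 - g p.2) ^ 2 ∂(π ⊗ₘ P))
      = ∫ p, (g p.1 - g p.2) ^ 2 ∂(π ⊗ₘ P) := by field_simp
  rw [e] at this
  linarith

theorem exists_median (π : Measure X) [IsProbabilityMeasure π] {f : X → ℝ}
    (hf : f ∈ boundedMeasurable X) :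
    ∃ m : ℝ, π {x | m < f x} ≤ 1 / 2 ∧ π {x | f x < m} ≤ 1 / 2 := by
  obtain ⟨hfm, C, hC⟩ := hf
  -- The infimum of `T` is a median; both strict inequalities at it follow from monotone limits of
  -- level sets.
  set T : Set ℝ := {t | π {x | t < f x} ≤ 1 / 2} with hT
  have hne : C ∈ T := by
    have : {x | C < f x} = ∅ := by
      ext x
      simpa using (le_abs_self _).trans (hC x)
    simp [hT, this]
  have hbdd : ∀ t ∈ T, -C - 1 ≤ t := by
    intro t ht
    by_contra! hlt
    have : {x | t < f x} = Set.univ := by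
      ext x
      have := neg_abs_le (f x)
      have := hC x
      simp only [Set.mem_ofPred_eq, Set.mem_univ, iff_true]
      linarith
    rw [hT, Set.mem_ofPred_eq, this, measure_univ] at ht
    exact absurd ht (by norm_num)
  have hBB : BddBelow T := ⟨_, hbdd⟩
  have hup : ∀ t, sInf T < t → π {x | t < f x} ≤ 1 / 2 := by
    intro t ht
    obtain ⟨s, hs, hst⟩ := exists_lt_of_csInf_lt ⟨C, hne⟩ ht
    exact (measure_mono fun x (hx : t < f x) => (hst.trans hx : s < f x)).trans hs
  have hdown : ∀ t, t < sInf T → π {x | f x ≤ t} ≤ 1 / 2 := by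
    intro t ht
    have h1 : ¬ π {x | t < f x} ≤ 1 / 2 := fun h => absurd (csInf_le hBB h) (not_le.2 ht)
    have h2 : {x | f x ≤ t} = {x | t < f x}ᶜ := by
      ext x
      simp
    rw [h2, prob_compl_eq_one_sub (measurableSet_lt measurable_const hfm)]
    refine (tsub_le_tsub_left (not_le.1 h1).le 1).trans ?_
    norm_num
  obtain ⟨u, hu, hu', hulim⟩ := exists_seq_strictAnti_tendsto (sInf T)
  obtain ⟨v, hv, hv', hvlim⟩ := exists_seq_strictMono_tendsto (sInf T)
  refine ⟨sInf T, ?_, ?_⟩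
  · have hU : {x | sInf T < f x} = ⋃ n, {x | u n < f x} := by
      ext x
      simp only [Set.mem_ofPred_eq, Set.mem_iUnion]
      exact ⟨fun hx => (hulim.eventually (gt_mem_nhds hx)).exists,
        fun ⟨n, hn⟩ => (hu' n).trans hn⟩
    have hmono : Monotone fun n => {x | u n < f x} :=
      fun a b hab x (hx : u a < f x) => (hu.antitone hab).trans_lt hx
    rw [hU, hmono.measure_iUnion]
    exact iSup_le fun n => hup _ (hu' n)
  · have hU : {x | f x < sInf T} = ⋃ n, {x | f x ≤ v n} := by
      ext x
      simp only [Set.mem_ofPred_eq, Set.mem_iUnion]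
      exact ⟨fun hx => (hvlim.eventually (lt_mem_nhds hx)).exists.imp fun n hn => hn.le,
        fun ⟨n, hn⟩ => hn.trans_lt (hv' n)⟩
    have hmono : Monotone fun n => {x | f x ≤ v n} :=
      fun a b hab x (hx : f x ≤ v a) => hx.trans (hv.monotone hab)
    rw [hU, hmono.measure_iUnion]
    exact iSup_le fun n => hdown _ (hv' n)

/-- Cheeger's inequality for an invariant kernel and a bounded function. -/
theorem cheeger {P : Kernel X X} [IsMarkovKernel P] {π : Measure X} [IsProbabilityMeasure π]
    (h : P.Invariant π) {φ : ℝ} (hφ : 0 < φ)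
    (hflow : ∀ S, MeasurableSet S → π S ≤ 1 / 2 → ENNReal.ofReal φ * π S ≤ flow π P S)
    {f : X → ℝ} (hf : f ∈ boundedMeasurable X) :
    φ ^ 2 * (∫ x, f x ^ 2 ∂π - (∫ x, f x ∂π) ^ 2)
      ≤ ∫ p, (f p.1 - f p.2) ^ 2 ∂(π ⊗ₘ P) := by
  obtain ⟨m, hm1, hm2⟩ := exists_median π hf
  obtain ⟨hfm, C, hC⟩ := id hf
  have hfm' : (fun x => f x - m) ∈ boundedMeasurable X :=
    Submodule.sub_mem _ hf (const_mem_boundedMeasurable m)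
  have hpos : ∀ {u : X → ℝ}, u ∈ boundedMeasurable X →
      (fun x => max (u x) 0) ∈ boundedMeasurable X := by
    rintro u ⟨hu, D, hD⟩
    refine mem_boundedMeasurable_of_mem_Icc (a := |D|) (hu.max measurable_const) fun x => ?_
    exact ⟨le_max_right _ _,
      max_le ((le_abs_self _).trans ((hD x).trans (le_abs_self D))) (abs_nonneg D)⟩
  have hg := hpos hfm'
  have hk := hpos (Submodule.neg_mem _ hfm')
  have hcg := cheeger_of_nonneg h hφ hflow hg (fun x => le_max_right _ _) (by
    simpa [lt_max_iff] using hm1)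
  have hck := cheeger_of_nonneg h hφ hflow hk (fun x => le_max_right _ _) (by
    simpa [lt_max_iff] using hm2)
  have hsq : ∀ {Y : Type _} [MeasurableSpace Y] {u : Y → ℝ}, u ∈ boundedMeasurable Y →
      ∀ (ν : Measure Y) [IsFiniteMeasure ν], Integrable (fun x => u x ^ 2) ν := by
    intro Y _ u hu ν _
    simpa only [sq] using integrable_of_bounded (mul_mem_boundedMeasurable hu hu) ν
  have hdiff : ∀ {u : X → ℝ}, u ∈ boundedMeasurable X →
      (fun p : X × X => u p.1 - u p.2) ∈ boundedMeasurable (X × X) := fun hu =>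
    Submodule.sub_mem _ (comp_mem_boundedMeasurable hu measurable_fst)
      (comp_mem_boundedMeasurable hu measurable_snd)
  have hvar : ∫ x, f x ^ 2 ∂π - (∫ x, f x ∂π) ^ 2 ≤ ∫ x, (f x - m) ^ 2 ∂π := by
    have e : (fun x => (f x - m) ^ 2) = fun x => f x ^ 2 - (2 * m) * f x + m ^ 2 := by
      ext x; ring
    have i1 := hsq hf π
    have i2 := (integrable_of_bounded hf π).const_mul (2 * m)
    rw [e, integral_add (by exact i1.sub i2) (integrable_const _), integral_sub i1 i2,
      integral_const_mul, integral_const, probReal_univ, one_smul]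
    nlinarith [sq_nonneg (∫ x, f x ∂π - m)]
  have hsplit : ∫ x, (f x - m) ^ 2 ∂π
      = ∫ x, max (f x - m) 0 ^ 2 ∂π + ∫ x, max ((-fun x => f x - m) x) 0 ^ 2 ∂π := by
    rw [← integral_add (hsq hg π) (hsq hk π)]
    congr 1
    ext x
    simp only [Pi.neg_apply]
    rcases le_total 0 (f x - m) with hx | hx
    · rw [max_eq_left hx, max_eq_right (by linarith)]; ring
    · rw [max_eq_right hx, max_eq_left (by linarith)]; ring
  -- The parts above and below the median have increments of the same sign, so the squares of their
  -- increments add up to at most the square of the increment of `f`.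
  have hE : ∫ p, (max (f p.1 - m) 0 - max (f p.2 - m) 0) ^ 2 ∂(π ⊗ₘ P)
      + ∫ p, (max ((-fun x => f x - m) p.1) 0 - max ((-fun x => f x - m) p.2) 0) ^ 2 ∂(π ⊗ₘ P)
      ≤ ∫ p, (f p.1 - f p.2) ^ 2 ∂(π ⊗ₘ P) := by
    rw [← integral_add (hsq (hdiff hg) _) (hsq (hdiff hk) _)]
    refine integral_mono ((hsq (hdiff hg) _).add (hsq (hdiff hk) _)) (hsq (hdiff hf) _)
      fun p => ?_
    simp only [Pi.neg_apply]
    rcases le_total 0 (f p.1 - m) with hx | hx <;> rcases le_total 0 (f p.2 - m) with hy | hy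
    · rw [max_eq_left hx, max_eq_left hy, max_eq_right (by linarith), max_eq_right (by linarith)]
      apply le_of_eq; ring
    · rw [max_eq_left hx, max_eq_right hy, max_eq_right (by linarith), max_eq_left (by linarith)]
      nlinarith [mul_nonneg hx (neg_nonneg.2 hy)]
    · rw [max_eq_right hx, max_eq_left hy, max_eq_left (by linarith), max_eq_right (by linarith)]
      nlinarith [mul_nonneg hy (neg_nonneg.2 hx)]
    · rw [max_eq_right hx, max_eq_right hy, max_eq_left (by linarith), max_eq_left (by linarith)]
      apply le_of_eq; ring
  calc _ ≤ φ ^ 2 * ∫ x, (f x - m) ^ 2 ∂π := mul_le_mul_of_nonneg_left hvar (sq_nonneg φ)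
    _ ≤ _ := by rw [hsplit, mul_add]; exact (add_le_add hcg hck).trans hE

end Conductance

/-! ### From Cheeger's inequality to the spectral gap and to decay of the variance. -/

section SpectralGap

variable {X : Type*} [MeasurableSpace X]

theorem abs_clamp_le (N t : ℝ) (hN : 0 ≤ N) : |max (-N) (min N t)| ≤ |t| := by
  rcases le_total 0 t with h | h
  · rw [max_eq_right (le_trans (neg_nonpos.2 hN) (le_min hN h)), abs_of_nonneg (le_min hN h),
      abs_of_nonneg h]
    exact min_le_right _ _
  · rw [min_eq_right (h.trans hN), abs_of_nonpos h,
      abs_of_nonpos (max_le (neg_nonpos.2 hN) h)]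
    exact neg_le_neg (le_max_right _ _)

/-- A variance bound by the Dirichlet form extends from bounded functions to `L²`. -/
theorem variance_le_of_bounded {P : Kernel X X} [IsMarkovKernel P] {π : Measure X}
    [IsProbabilityMeasure π] (h : P.Invariant π) {a : ℝ}
    (hb : ∀ f ∈ boundedMeasurable X, a * (∫ x, f x ^ 2 ∂π - (∫ x, f x ∂π) ^ 2)
      ≤ ∫ p, (f p.1 - f p.2) ^ 2 ∂(π ⊗ₘ P)) {f : X → ℝ} (hf : MemLp f 2 π) :
    a * (∫ x, f x ^ 2 ∂π - (∫ x, f x ∂π) ^ 2) ≤ ∫ p, (f p.1 - f p.2) ^ 2 ∂(π ⊗ₘ P) := by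
  set g : X → ℝ := hf.1.mk f with hg
  have hgm : Measurable g := hf.1.stronglyMeasurable_mk.measurable
  have hfg : f =ᵐ[π] g := hf.1.ae_eq_mk
  have hgL : MemLp g 2 π := (memLp_congr_ae hfg).1 hf
  have m1 := measurePreserving_fst_compProd π P
  have m2 := measurePreserving_snd_compProd h
  have hR : ∫ p, (f p.1 - f p.2) ^ 2 ∂(π ⊗ₘ P) = ∫ p, (g p.1 - g p.2) ^ 2 ∂(π ⊗ₘ P) := by
    refine integral_congr_ae ?_
    filter_upwards [m1.quasiMeasurePreserving.ae hfg, m2.quasiMeasurePreserving.ae hfg]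
      with p h1 h2
    rw [h1, h2]
  have hS : ∫ x, f x ^ 2 ∂π = ∫ x, g x ^ 2 ∂π :=
    integral_congr_ae (hfg.mono fun x hx => by simp only [hx])
  rw [hR, hS, integral_congr_ae hfg]
  set c : ℕ → X → ℝ := fun N x => max (-(N : ℝ)) (min N (g x)) with hc
  have hcm : ∀ N, Measurable (c N) := fun N => measurable_const.max (measurable_const.min hgm)
  have hcb : ∀ N, c N ∈ boundedMeasurable X := fun N =>
    ⟨hcm N, N, fun x => abs_le.2 ⟨le_max_left _ _,
      max_le (by linarith [(Nat.cast_nonneg N : (0 : ℝ) ≤ N)]) (min_le_left _ _)⟩⟩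
  have hcle : ∀ N x, |c N x| ≤ |g x| := fun N x => abs_clamp_le _ _ (Nat.cast_nonneg N)
  have hclim : ∀ x, Tendsto (fun N => c N x) atTop (𝓝 (g x)) := by
    intro x
    refine tendsto_const_nhds.congr' ?_
    obtain ⟨N0, hN0⟩ := exists_nat_ge |g x|
    filter_upwards [eventually_ge_atTop N0] with N hN
    have h1 : |g x| ≤ N := hN0.trans (by exact_mod_cast hN)
    rw [abs_le] at h1
    rw [hc]
    simp only
    rw [min_eq_right h1.2, max_eq_right h1.1]
  have l1 : Tendsto (fun N => ∫ x, c N x ∂π) atTop (𝓝 (∫ x, g x ∂π)) :=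
    tendsto_integral_of_dominated_convergence (fun x => |g x|)
      (fun N => (hcm N).aestronglyMeasurable) ((hgL.integrable one_le_two).abs)
      (fun N => ae_of_all _ (hcle N)) (ae_of_all _ hclim)
  have l2 : Tendsto (fun N => ∫ x, c N x ^ 2 ∂π) atTop (𝓝 (∫ x, g x ^ 2 ∂π)) := by
    refine tendsto_integral_of_dominated_convergence (fun x => g x ^ 2)
      (fun N => ((hcm N).pow_const 2).aestronglyMeasurable) hgL.integrable_sq
      (fun N => ae_of_all _ fun x => ?_) (ae_of_all _ fun x => (hclim x).pow 2)
    rw [Real.norm_eq_abs, abs_of_nonneg (sq_nonneg _)]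
    exact sq_le_sq.2 (hcle N x)
  refine le_of_tendsto ((l2.sub (l1.pow 2)).const_mul a) (Eventually.of_forall fun N => ?_)
  refine (hb _ (hcb N)).trans ?_
  have hcL : MemLp (c N) 2 π := hgL.mono (hcm N).aestronglyMeasurable (ae_of_all _ (hcle N))
  -- Clamping is 1-Lipschitz, so truncation does not increase the Dirichlet form.
  refine integral_mono (integral_sub_sq_eq h hcL).1 (integral_sub_sq_eq h hgL).1 fun p => ?_
  refine sq_le_sq.2 ?_
  calc |c N p.1 - c N p.2| ≤ |min (N : ℝ) (g p.1) - min (N : ℝ) (g p.2)| := by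
        have := abs_max_sub_max_le_max (-(N : ℝ)) (min (N : ℝ) (g p.1)) (-(N : ℝ))
          (min (N : ℝ) (g p.2))
        simpa using this
    _ ≤ |g p.1 - g p.2| := by
        have := abs_min_sub_min_le_max (N : ℝ) (g p.1) (N : ℝ) (g p.2)
        simpa using this

theorem form_self_nonneg (π : Measure X) [IsProbabilityMeasure π] (f : boundedMeasurable X) :
    0 ≤ form π f f :=
  integral_nonneg fun x => mul_self_nonneg (f.1 x)

theorem memLp_of_bounded {f : X → ℝ} (hf : f ∈ boundedMeasurable X) (π : Measure X)
    [IsFiniteMeasure π] : MemLp f 2 π := by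
  obtain ⟨hm, C, hC⟩ := hf
  exact MemLp.of_bound hm.aestronglyMeasurable C (ae_of_all _ hC)

theorem integral_sub_sq_eq_form {P : Kernel X X} [IsMarkovKernel P] {π : Measure X}
    [IsProbabilityMeasure π] (h : P.Invariant π) (f : boundedMeasurable X) :
    ∫ p, (f.1 p.1 - f.1 p.2) ^ 2 ∂(π ⊗ₘ P) = 2 * (form π f f - form π f (avg P f)) := by
  have h1 := (integral_sub_sq_eq h (memLp_of_bounded f.2 π)).2
  have h2 : ∫ x, f.1 x * (f.1 x - ∫ y, f.1 y ∂(P x)) ∂π = form π f (f - avg P f) := rfl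
  rw [h2, map_sub] at h1
  linarith

/-- The spectral gap of a positive self-adjoint kernel, from a lower bound on the conductance of
its `n`-th power. -/
theorem gap_of_flow_pow {P : Kernel X X} [IsMarkovKernel P] {π : Measure X}
    [IsProbabilityMeasure π] (h : P.Invariant π)
    (hsymm : ∀ f g, form π (avg P f) g = form π f (avg P g))
    (hpos : ∀ f, form π (avg P f) (avg P f) ≤ form π f (avg P f))
    {n : ℕ} (hn : 0 < n) {φ : ℝ} (hφ : 0 < φ)
    (hflow : ∀ S, MeasurableSet S → π S ≤ 1 / 2 → ENNReal.ofReal φ * π S ≤ flow π (P ^ n) S)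
    {f : X → ℝ} (hf : MemLp f 2 π) (hf0 : ∫ x, f x ∂π = 0) :
    φ ^ 2 / (2 * n) * ∫ x, f x ^ 2 ∂π ≤ ∫ x, f x * (f x - ∫ y, f y ∂(P x)) ∂π := by
  have hn' : (0 : ℝ) < n := by exact_mod_cast hn
  have hb : ∀ f ∈ boundedMeasurable X, φ ^ 2 / n * (∫ x, f x ^ 2 ∂π - (∫ x, f x ∂π) ^ 2)
      ≤ ∫ p, (f p.1 - f p.2) ^ 2 ∂(π ⊗ₘ P) := by
    intro f hf
    have h1 := cheeger (invariant_pow h n) hφ hflow hf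
    rw [integral_sub_sq_eq_form (invariant_pow h n) ⟨f, hf⟩, avg_pow] at h1
    -- Passing from `P ^ n` back to `P` here, after Cheeger, costs a single factor `n` instead of
    -- the `n²` that squaring `φ / n` would cost.
    have h2 := form_sub_pow_le (form π) (avg P) (form_self_nonneg π) hsymm hpos n ⟨f, hf⟩
    have h3 := integral_sub_sq_eq_form h ⟨f, hf⟩
    simp only at h3
    rw [h3, div_mul_eq_mul_div, div_le_iff₀ hn']
    linarith
  have h1 := variance_le_of_bounded h hb hf
  have h2 := (integral_sub_sq_eq h hf).2
  rw [hf0] at h1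
  have h3 : φ ^ 2 / (2 * n) * ∫ x, f x ^ 2 ∂π = 1 / 2 * (φ ^ 2 / n * ∫ x, f x ^ 2 ∂π) := by
    field_simp
  rw [h2, h3]
  linarith

/-- Decay of the variance of `P ^ n 1_S`. -/
theorem integral_avg_pow_sq_le {P : Kernel X X} [IsMarkovKernel P] {π : Measure X}
    [IsProbabilityMeasure π] (h : P.Invariant π)
    (hpos : ∀ f, form π (avg P f) (avg P f) ≤ form π f (avg P f)) {l : ℝ}
    (hgap : ∀ f : X → ℝ, MemLp f 2 π → ∫ x, f x ∂π = 0 →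
      l * ∫ x, f x ^ 2 ∂π ≤ ∫ x, f x * (f x - ∫ y, f y ∂(P x)) ∂π) (hl : l ≤ 1)
    (f : boundedMeasurable X) (hf : ∫ x, f.1 x ∂π = 0) (n : ℕ) :
    form π ((avg P ^ n) f) ((avg P ^ n) f) ≤ (1 - l) ^ n * form π f f := by
  have hzero : ∀ n, ∫ x, ((avg P ^ n) f).1 x ∂π = 0 := by
    intro n
    rw [← avg_pow, integral_avg (invariant_pow h n), hf]
  induction n with
  | zero => simp
  | succ n ih =>
    rw [pow_succ', Module.End.mul_apply]
    set g := (avg P ^ n) f with hg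
    have h1 := hgap g.1 (memLp_of_bounded g.2 π) (hzero n)
    have h2 : ∫ x, g.1 x * (g.1 x - ∫ y, g.1 y ∂(P x)) ∂π = form π g (g - avg P g) := rfl
    have h3 : ∫ x, g.1 x ^ 2 ∂π = form π g g := by simp only [sq, form_apply]
    rw [h2, h3, map_sub] at h1
    calc form π (avg P g) (avg P g) ≤ form π g (avg P g) := hpos g
      _ ≤ (1 - l) * form π g g := by linarith
      _ ≤ (1 - l) * ((1 - l) ^ n * form π f f) :=
          mul_le_mul_of_nonneg_left ih (by linarith)
      _ = (1 - l) ^ (n + 1) * form π f f := by ring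

end SpectralGap

/-! ### Mixing time from a warm start. -/

section Mixing

variable {X : Type*} [MeasurableSpace X]

/-- The indicator of a measurable set as a bounded measurable function. -/
noncomputable def boundedIndicator (S : Set X) (hS : MeasurableSet S) : boundedMeasurable X :=
  ⟨S.indicator 1, mem_boundedMeasurable_of_mem_Icc (measurable_one.indicator hS) (a := 1)
    fun x => by by_cases hx : x ∈ S <;> simp [hx]⟩

theorem avg_boundedIndicator (P : Kernel X X) [IsMarkovKernel P] {S : Set X}
    (hS : MeasurableSet S) (x : X) : (avg P (boundedIndicator S hS)).1 x = (P x).real S :=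
  integral_indicator_one hS

theorem sq_integral_le_of_le_smul {μ π : Measure X} [IsProbabilityMeasure μ]
    [IsProbabilityMeasure π] {Ω : ℝ} (hΩ : 0 ≤ Ω)
    (hμ : ∀ S, MeasurableSet S → μ S ≤ ENNReal.ofReal Ω * π S) {f : X → ℝ}
    (hf : f ∈ boundedMeasurable X) : (∫ x, f x ∂μ) ^ 2 ≤ Ω * ∫ x, f x ^ 2 ∂π := by
  have hle : μ ≤ ENNReal.ofReal Ω • π := Measure.le_iff.2 fun S hS => by
    simpa using hμ S hS
  have hsq : (fun x => f x ^ 2) ∈ boundedMeasurable X := by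
    simpa only [sq] using mul_mem_boundedMeasurable hf hf
  have h1 : (∫ x, f x ∂μ) ^ 2 ≤ ∫ x, f x ^ 2 ∂μ := by
    have h0 : 0 ≤ ∫ x, (f x - ∫ y, f y ∂μ) ^ 2 ∂μ := integral_nonneg fun x => sq_nonneg _
    set m := ∫ y, f y ∂μ with hm
    have e : (fun x => (f x - m) ^ 2) = fun x => f x ^ 2 - (2 * m) * f x + m ^ 2 := by
      ext x; ring
    have i1 := integrable_of_bounded hsq μ
    have i2 := (integrable_of_bounded hf μ).const_mul (2 * m)
    rw [e, integral_add (by exact i1.sub i2) (integrable_const _), integral_sub i1 i2,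
      integral_const_mul, integral_const, probReal_univ, one_smul, ← hm] at h0
    nlinarith
  have : IsFiniteMeasure (ENNReal.ofReal Ω • π) := Measure.smul_finite π ENNReal.ofReal_ne_top
  refine h1.trans ?_
  calc ∫ x, f x ^ 2 ∂μ ≤ ∫ x, f x ^ 2 ∂(ENNReal.ofReal Ω • π) :=
        integral_mono_measure hle (ae_of_all _ fun x => sq_nonneg _)
          (integrable_of_bounded hsq _)
    _ = Ω * ∫ x, f x ^ 2 ∂π := by
        rw [integral_smul_measure, ENNReal.toReal_ofReal hΩ, smul_eq_mul]

theorem bdd_tvDist (μ ν : Measure X) [IsProbabilityMeasure μ] [IsProbabilityMeasure ν] :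
    BddAbove (Set.range fun S : {S : Set X // MeasurableSet S} => |μ.real S.1 - ν.real S.1|) := by
  refine ⟨1, ?_⟩
  rintro _ ⟨S, rfl⟩
  exact abs_sub_le_of_nonneg_of_le measureReal_nonneg measureReal_le_one measureReal_nonneg
    measureReal_le_one

theorem abs_measureReal_sub_le_tvDist (μ ν : Measure X) [IsProbabilityMeasure μ]
    [IsProbabilityMeasure ν] {S : Set X} (hS : MeasurableSet S) :
    |μ.real S - ν.real S| ≤ tvDist μ ν :=
  le_ciSup (bdd_tvDist μ ν) ⟨S, hS⟩

/-- By duality `μ P ^ n (S) - π S` is the `μ`-mean of `P ^ n (1_S - π S)`. The warm start bounds its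
square by `Ω` times a second moment under `π`, which decays by the gap. -/
theorem tvDist_bind_pow_le {P : Kernel X X} [IsMarkovKernel P] {π μ : Measure X}
    [IsProbabilityMeasure π] [IsProbabilityMeasure μ] (h : P.Invariant π)
    (hpos : ∀ f, form π (avg P f) (avg P f) ≤ form π f (avg P f)) {l : ℝ}
    (hgap : ∀ f : X → ℝ, MemLp f 2 π → ∫ x, f x ∂π = 0 →
      l * ∫ x, f x ^ 2 ∂π ≤ ∫ x, f x * (f x - ∫ y, f y ∂(P x)) ∂π) (hl : l ≤ 1)
    {Ω : ℝ} (hΩ : 0 ≤ Ω) (hμ : ∀ S, MeasurableSet S → μ S ≤ ENNReal.ofReal Ω * π S) (n : ℕ) :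
    tvDist ((P ^ n) ∘ₘ μ) π ≤ √(Ω * ((1 - l) ^ n * (1 / 4))) := by
  have : Nonempty {S : Set X // MeasurableSet S} := ⟨⟨∅, MeasurableSet.empty⟩⟩
  refine ciSup_le fun ⟨S, hS⟩ => ?_
  simp only
  set s := π.real S with hs
  set c : boundedMeasurable X := ⟨fun _ => s, const_mem_boundedMeasurable s⟩ with hc
  set f : boundedMeasurable X := boundedIndicator S hS - c with hf
  have hfx : ∀ x, f.1 x = S.indicator 1 x - s := fun x => rfl
  have hI : ∫ x, S.indicator (1 : X → ℝ) x ∂π = s := integral_indicator_one hS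
  have hi : Integrable (S.indicator (1 : X → ℝ)) π :=
    integrable_of_bounded (boundedIndicator S hS).2 π
  have hf0 : ∫ x, f.1 x ∂π = 0 := by
    simp only [hfx]
    rw [integral_sub hi (integrable_const _), hI, integral_const, probReal_univ, one_smul,
      sub_self]
  -- The variance of an indicator is `s (1 - s) ≤ 1 / 4`. The resulting factor `1 / 2` in total
  -- variation is what lets `n = 0` suffice when `ζ` is close to `√Ω`.
  have hff : form π f f ≤ 1 / 4 := by
    have e : form π f f = ∫ x, ((1 - 2 * s) * S.indicator 1 x + s ^ 2) ∂π := by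
      rw [form_apply]
      refine integral_congr_ae (ae_of_all _ fun x => ?_)
      simp only [hfx]
      by_cases hx : x ∈ S <;> simp [hx] <;> ring
    rw [e, integral_add (hi.const_mul _) (integrable_const _), integral_const_mul, hI,
      integral_const, probReal_univ, one_smul]
    nlinarith [sq_nonneg (s - 1 / 2)]
  have hdec := integral_avg_pow_sq_le h hpos hgap hl f hf0 n
  have hgn : ∀ x, ((avg P ^ n) f).1 x = ((P ^ n) x).real S - s := by
    intro x
    have h1 : avg (P ^ n) c = c := by
      ext x
      rw [avg_apply]
      simp [hc]
    rw [← avg_pow, hf, map_sub, h1, ← avg_boundedIndicator (P ^ n) hS]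
    rfl
  have hstep : ((P ^ n) ∘ₘ μ).real S - s = ∫ x, ((avg P ^ n) f).1 x ∂μ := by
    simp only [hgn]
    have i1 : Integrable (fun x => ((P ^ n) x).real S) μ := by
      simp only [← avg_boundedIndicator (P ^ n) hS]
      exact integrable_of_bounded (avg (P ^ n) (boundedIndicator S hS)).2 μ
    rw [integral_sub i1 (integrable_const _), integral_const, probReal_univ, one_smul]
    congr 1
    rw [measureReal_def, Measure.bind_apply hS (P ^ n).aemeasurable]
    exact (integral_toReal ((P ^ n).measurable_coe hS).aemeasurable
      (ae_of_all _ fun x => measure_lt_top _ _)).symm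
  rw [hstep]
  refine Real.abs_le_sqrt ((sq_integral_le_of_le_smul hΩ hμ ((avg P ^ n) f).2).trans ?_)
  refine mul_le_mul_of_nonneg_left ?_ hΩ
  have e : ∫ x, ((avg P ^ n) f).1 x ^ 2 ∂π = form π ((avg P ^ n) f) ((avg P ^ n) f) := by
    simp only [sq, form_apply]
  rw [e]
  exact hdec.trans (mul_le_mul_of_nonneg_left hff (pow_nonneg (by linarith) n))

end Mixing

theorem stepLaw_eq {d : ℕ} (μ : Measure (E d)) (P : Kernel (E d) (E d)) (n : ℕ) :
    stepLaw μ P n = (P ^ n) ∘ₘ μ := by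
  induction n with
  | zero => exact Measure.id_comp.symm
  | succ n ih =>
    rw [kernel_pow_succ', ← Measure.comp_assoc, ← ih, stepLaw, stepLaw, Function.iterate_succ_apply']

theorem mixingTime_le {d : ℕ} {P : Kernel (E d) (E d)} [IsMarkovKernel P] {π μ : Measure (E d)}
    [IsProbabilityMeasure π] [IsProbabilityMeasure μ] (h : P.Invariant π)
    (hpos : ∀ f, form π (avg P f) (avg P f) ≤ form π f (avg P f)) {l : ℝ}
    (hgap : ∀ f : E d → ℝ, MemLp f 2 π → ∫ x, f x ∂π = 0 →
      l * ∫ x, f x ^ 2 ∂π ≤ ∫ x, f x * (f x - ∫ y, f y ∂(P x)) ∂π) (hl0 : 0 < l) (hl : l ≤ 1)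
    {Ω ζ : ℝ} (hμ : WarmStart μ π Ω) (hζ : 0 < ζ) (hζΩ : ζ ≤ √Ω) :
    ((mixingTime μ π P ζ : ℕ∞) : ℝ≥0∞) ≤ ENNReal.ofReal (4 / l * Real.log (√Ω / ζ)) := by
  have hsΩ : 0 < √Ω := hζ.trans_le hζΩ
  have hΩ : 0 < Ω := Real.sqrt_pos.1 hsΩ
  have htv := fun n => tvDist_bind_pow_le h hpos hgap hl hΩ.le hμ n
  have hmix : ∀ n : ℕ, √(Ω * ((1 - l) ^ n * (1 / 4))) ≤ ζ →
      ((mixingTime μ π P ζ : ℕ∞) : ℝ≥0∞) ≤ n := by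
    intro n hn
    have : mixingTime μ π P ζ ≤ n := iInf₂_le n (by rw [stepLaw_eq]; exact (htv n).trans hn)
    exact_mod_cast this
  set L := Real.log (√Ω / ζ) with hL
  have hhalf : √(1 / 4 : ℝ) = 1 / 2 := by
    rw [show (1 / 4 : ℝ) = (1 / 2) ^ 2 by norm_num]
    exact Real.sqrt_sq (by norm_num)
  rcases le_or_gt (√Ω / 2) ζ with hcase | hcase
  -- Here the logarithm may vanish, so no additive constant could be absorbed; zero steps must do.
  · refine (hmix 0 ?_).trans (by simp)
    rw [pow_zero, one_mul, Real.sqrt_mul hΩ.le, hhalf]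
    linarith
  · have hL2 : 1 / 2 ≤ L := by
      have h1 : Real.log 2 ≤ L := Real.log_le_log two_pos (by rw [le_div_iff₀ hζ]; linarith)
      linarith [Real.log_two_gt_d9]
    -- `(1 - l) ^ n ≤ exp (-2L) = ζ² / Ω` holds once `l n ≥ 2L`. The rounding error 1 is absorbed by
    -- doubling, because `L ≥ 1 / 2` and `l ≤ 1`.
    set n := ⌈2 / l * L⌉₊ with hn
    have hn1 : 2 / l * L ≤ n := Nat.le_ceil _
    have hn2 : (n : ℝ) < 2 / l * L + 1 := Nat.ceil_lt_add_one (by positivity)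
    refine (hmix n ?_).trans ?_
    · have h1 : (1 - l) ^ n ≤ (ζ / √Ω) ^ 2 := by
        calc (1 - l) ^ n ≤ (Real.exp (-l)) ^ n :=
              pow_le_pow_left₀ (by linarith) (by linarith [Real.add_one_le_exp (-l)]) n
          _ = Real.exp (-(l * n)) := by rw [← Real.exp_nat_mul]; ring_nf
          _ ≤ Real.exp (-(2 * L)) := by
              refine Real.exp_le_exp.2 (neg_le_neg ?_)
              have := mul_le_mul_of_nonneg_left hn1 hl0.le
              have e : l * (2 / l * L) = 2 * L := by field_simp
              linarith
          _ = (ζ / √Ω) ^ 2 := by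
              rw [← neg_mul, neg_mul, ← mul_neg, two_mul, Real.exp_add, hL, Real.exp_neg,
                Real.exp_log (div_pos hsΩ hζ), inv_div, sq]
      rw [Real.sqrt_le_left hζ.le]
      calc Ω * ((1 - l) ^ n * (1 / 4)) ≤ Ω * ((ζ / √Ω) ^ 2 * (1 / 4)) := by gcongr
        _ = ζ ^ 2 / 4 := by rw [div_pow, Real.sq_sqrt hΩ.le]; field_simp
        _ ≤ ζ ^ 2 := by nlinarith [sq_nonneg ζ]
    · rw [← ENNReal.ofReal_natCast]
      refine ENNReal.ofReal_le_ofReal (hn2.le.trans ?_)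
      have h1 : 1 ≤ 1 / l := by rw [le_div_iff₀ hl0]; linarith
      have e : 4 / l * L = 2 / l * L + (1 / l) * (2 * L) := by ring
      rw [e]
      nlinarith

/-! ### Resampling operators as projections, and positivity of the random scan. -/

section CoordinateResampling

variable {d : ℕ}

theorem setCoord_self (k : Fin d) (x : E d) (t : ℝ) : setCoord k x t k = t := by
  simp [setCoord]

theorem setCoord_of_ne {j k : Fin d} (h : j ≠ k) (x : E d) (t : ℝ) : setCoord k x t j = x j := by
  simp [setCoord, h]

theorem dropCoord_setCoord (k : Fin d) (x : E d) (t : ℝ) :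
    dropCoord k (setCoord k x t) = dropCoord k x := by
  ext j
  exact setCoord_of_ne j.2 x t

theorem setCoord_setCoord (k : Fin d) (x : E d) (s t : ℝ) :
    setCoord k (setCoord k x s) t = setCoord k x t := by
  ext j
  by_cases h : j = k
  · subst h
    rw [setCoord_self, setCoord_self]
  · rw [setCoord_of_ne h, setCoord_of_ne h, setCoord_of_ne h]

theorem measurable_setCoord_right (k : Fin d) (x : E d) : Measurable (setCoord k x) :=
  (measurable_setCoord k).comp measurable_prodMk_left

/-- Reassemble a point from its `k`-th coordinate and the others. -/
noncomputable def insertCoord (k : Fin d) (p : ECompl k × ℝ) : E d :=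
  WithLp.toLp 2 fun j => if h : j = k then p.2 else p.1 ⟨j, h⟩

theorem measurable_insertCoord (k : Fin d) : Measurable (insertCoord k) := by
  unfold insertCoord
  refine (WithLp.measurable_toLp 2 _).comp (measurable_pi_lambda _ fun j => ?_)
  by_cases h : j = k
  · simpa [h] using measurable_snd
  · simp only [h, dite_false]
    fun_prop

theorem insertCoord_dropCoord (k : Fin d) (x : E d) (t : ℝ) :
    insertCoord k (dropCoord k x, t) = setCoord k x t := by
  ext j
  by_cases h : j = k
  · subst h
    simp [insertCoord, setCoord]
  · simp [insertCoord, setCoord, h, dropCoord]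

theorem insertCoord_dropCoord_self (k : Fin d) (x : E d) :
    insertCoord k (dropCoord k x, x k) = x := by
  rw [insertCoord_dropCoord]
  ext j
  by_cases h : j = k
  · subst h
    rw [setCoord_self]
  · rw [setCoord_of_ne h]

theorem coordKernel_apply (k : Fin d) (κ : Kernel (ECompl k) ℝ) [IsMarkovKernel κ] (x : E d) :
    coordKernel k κ x = (κ (dropCoord k x)).map (setCoord k x) := rfl

instance isMarkovKernel_coordKernel (k : Fin d) (κ : Kernel (ECompl k) ℝ) [IsMarkovKernel κ] :
    IsMarkovKernel (coordKernel k κ) :=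
  ⟨fun x => Measure.isProbabilityMeasure_map (measurable_setCoord_right k x).aemeasurable⟩

theorem randomScan_apply (κ : (k : Fin d) → Kernel (ECompl k) ℝ) [∀ k, IsMarkovKernel (κ k)]
    (x : E d) : randomScan κ x = (d : ℝ≥0∞)⁻¹ • ∑ k, coordKernel k (κ k) x := rfl

instance isMarkovKernel_randomScan [NeZero d] (κ : (k : Fin d) → Kernel (ECompl k) ℝ)
    [∀ k, IsMarkovKernel (κ k)] : IsMarkovKernel (randomScan κ) := by
  refine ⟨fun x => ⟨?_⟩⟩
  have hd : (d : ℝ≥0∞) ≠ 0 := by exact_mod_cast NeZero.ne d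
  simp [randomScan_apply, ENNReal.inv_mul_cancel hd (ENNReal.natCast_ne_top d)]

theorem invariant_coordKernel {k : Fin d} {κ : Kernel (ECompl k) ℝ} [IsMarkovKernel κ]
    {π : Measure (E d)} [IsProbabilityMeasure π] (h : IsConditional π k κ) :
    (coordKernel k κ).Invariant π := by
  refine Measure.ext fun S hS => ?_
  rw [Measure.bind_apply hS (coordKernel k κ).aemeasurable]
  have hT := measurable_insertCoord k hS
  have h1 : ∀ x, coordKernel k κ x S
      = κ (dropCoord k x) (Prod.mk (dropCoord k x) ⁻¹' (insertCoord k ⁻¹' S)) := by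
    intro x
    rw [coordKernel_apply, Measure.map_apply (measurable_setCoord_right k x) hS]
    congr 1
    ext t
    simp [insertCoord_dropCoord]
  have hm : Measurable fun x : E d => (dropCoord k x, x k) :=
    (measurable_dropCoord k).prodMk (by fun_prop)
  have : IsProbabilityMeasure (π.map (dropCoord k)) :=
    Measure.isProbabilityMeasure_map (measurable_dropCoord k).aemeasurable
  simp only [h1]
  rw [← lintegral_map (f := fun z => κ z (Prod.mk z ⁻¹' (insertCoord k ⁻¹' S)))
    (Kernel.measurable_kernel_prodMk_left hT) (measurable_dropCoord k),
    ← Measure.compProd_apply hT, ← h, Measure.map_apply hm hT]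
  congr 1
  ext x
  simp [insertCoord_dropCoord_self]

theorem invariant_randomScan [NeZero d] {κ : (k : Fin d) → Kernel (ECompl k) ℝ}
    [∀ k, IsMarkovKernel (κ k)] {π : Measure (E d)} [IsProbabilityMeasure π]
    (h : ∀ k, IsConditional π k (κ k)) : (randomScan κ).Invariant π := by
  refine Measure.ext fun S hS => ?_
  have hd : (d : ℝ≥0∞) ≠ 0 := by exact_mod_cast NeZero.ne d
  have hk : ∀ k, ∫⁻ x, coordKernel k (κ k) x S ∂π = π S := by
    intro k
    rw [← Measure.bind_apply hS (coordKernel k (κ k)).aemeasurable,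
      (invariant_coordKernel (h k)).def]
  rw [Measure.bind_apply hS (randomScan κ).aemeasurable]
  simp only [randomScan_apply, Measure.smul_apply, Measure.finsetSum_apply, smul_eq_mul]
  rw [lintegral_const_mul _ (Finset.measurable_sum _ fun k _ => Kernel.measurable_coe _ hS),
    lintegral_finsetSum _ fun k _ => Kernel.measurable_coe _ hS]
  simp only [hk, Finset.sum_const, Finset.card_univ, Fintype.card_fin, nsmul_eq_mul]
  rw [← mul_assoc, ENNReal.inv_mul_cancel hd (ENNReal.natCast_ne_top d), one_mul]

theorem avg_coordKernel_apply (k : Fin d) (κ : Kernel (ECompl k) ℝ) [IsMarkovKernel κ]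
    (f : boundedMeasurable (E d)) (x : E d) :
    (avg (coordKernel k κ) f).1 x = ∫ t, f.1 (setCoord k x t) ∂κ (dropCoord k x) := by
  rw [avg_apply, coordKernel_apply,
    integral_map (measurable_setCoord_right k x).aemeasurable f.2.1.aestronglyMeasurable]

theorem avg_coordKernel_setCoord (k : Fin d) (κ : Kernel (ECompl k) ℝ) [IsMarkovKernel κ]
    (f : boundedMeasurable (E d)) (x : E d) (t : ℝ) :
    (avg (coordKernel k κ) f).1 (setCoord k x t) = (avg (coordKernel k κ) f).1 x := by
  simp only [avg_coordKernel_apply, dropCoord_setCoord, setCoord_setCoord]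

/-- Resampling a coordinate is an orthogonal projection in `L²(π)`. -/
theorem form_avg_coordKernel {k : Fin d} {κ : Kernel (ECompl k) ℝ} [IsMarkovKernel κ]
    {π : Measure (E d)} [IsProbabilityMeasure π] (h : IsConditional π k κ)
    (f g : boundedMeasurable (E d)) : form π f (avg (coordKernel k κ) g)
      = form π (avg (coordKernel k κ) f) (avg (coordKernel k κ) g) := by
  -- Apply invariance of `P_k` to `F = f · P_k g`. Since `P_k g` does not depend on coordinate `k`,
  -- it factors out and `P_k F = P_k f · P_k g`.
  set F : boundedMeasurable (E d) :=
    ⟨fun x => f.1 x * (avg (coordKernel k κ) g).1 x, mul_mem_boundedMeasurable f.2 (Subtype.prop _)⟩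
    with hF
  rw [form_apply, form_apply]
  refine (integral_avg (invariant_coordKernel h) F).symm.trans ?_
  congr 1
  ext x
  rw [avg_coordKernel_apply]
  simp only [hF, avg_coordKernel_setCoord]
  rw [integral_mul_const, avg_coordKernel_apply k κ f]

theorem form_comm {X : Type*} [MeasurableSpace X] (π : Measure X) [IsProbabilityMeasure π]
    (f g : boundedMeasurable X) : form π f g = form π g f := by
  simp only [form_apply, mul_comm]

theorem avg_randomScan [NeZero d] (κ : (k : Fin d) → Kernel (ECompl k) ℝ)
    [∀ k, IsMarkovKernel (κ k)] (f : boundedMeasurable (E d)) :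
    avg (randomScan κ) f = (d : ℝ)⁻¹ • ∑ k, avg (coordKernel k (κ k)) f := by
  ext x
  have h1 : ((d : ℝ)⁻¹ • ∑ k, avg (coordKernel k (κ k)) f).1 x
      = (d : ℝ)⁻¹ * ∑ k, (avg (coordKernel k (κ k)) f).1 x := by
    simp [Finset.sum_apply]
  rw [h1, avg_apply, randomScan_apply, integral_smul_measure,
    integral_finsetSum_measure fun k _ => integrable_of_bounded f.2 _]
  simp [avg_apply]

theorem form_avg_randomScan_symm [NeZero d] {κ : (k : Fin d) → Kernel (ECompl k) ℝ}
    [∀ k, IsMarkovKernel (κ k)] {π : Measure (E d)} [IsProbabilityMeasure π]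
    (h : ∀ k, IsConditional π k (κ k)) (f g : boundedMeasurable (E d)) :
    form π (avg (randomScan κ) f) g = form π f (avg (randomScan κ) g) := by
  simp only [avg_randomScan, map_smul, map_sum, LinearMap.smul_apply, LinearMap.sum_apply]
  congr 2
  ext k
  rw [form_avg_coordKernel (h k) f g, form_comm π _ g, form_avg_coordKernel (h k) g f, form_comm]

/-- With `g k = P_k f` and mean `u`, expand `0 ≤ ∑ k, ‖g k - u‖²` and use `‖g k‖² = ⟨f, g k⟩`. -/
theorem form_avg_randomScan_le [NeZero d] {κ : (k : Fin d) → Kernel (ECompl k) ℝ}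
    [∀ k, IsMarkovKernel (κ k)] {π : Measure (E d)} [IsProbabilityMeasure π]
    (h : ∀ k, IsConditional π k (κ k)) (f : boundedMeasurable (E d)) :
    form π (avg (randomScan κ) f) (avg (randomScan κ) f) ≤ form π f (avg (randomScan κ) f) := by
  have hd : (d : ℝ) ≠ 0 := by exact_mod_cast NeZero.ne d
  set u := avg (randomScan κ) f with hu
  set g := fun k => avg (coordKernel k (κ k)) f with hg
  have hsum : ∑ k, g k = (d : ℝ) • u := by
    rw [hu, avg_randomScan, smul_smul, mul_inv_cancel₀ hd, one_smul]
  have h0 : 0 ≤ ∑ k, form π (g k - u) (g k - u) :=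
    Finset.sum_nonneg fun k _ => form_self_nonneg π _
  have h1 : ∀ k, form π (g k - u) (g k - u) = form π f (g k) - 2 * form π (g k) u + form π u u := by
    intro k
    rw [hg]
    simp only [map_sub, LinearMap.sub_apply]
    rw [form_avg_coordKernel (h k) f f, form_comm π u]
    ring
  have hs1 : ∑ k, form π f (g k) = d * form π f u := by
    rw [← map_sum, hsum, map_smul, smul_eq_mul]
  have hs2 : ∑ k, form π (g k) u = d * form π u u := by
    rw [← LinearMap.sum_apply, ← map_sum, hsum, map_smul, LinearMap.smul_apply, smul_eq_mul]
  simp only [h1] at h0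
  rw [Finset.sum_add_distrib, Finset.sum_sub_distrib, ← Finset.mul_sum, hs1, hs2] at h0
  simp only [Finset.sum_const, Finset.card_univ, Fintype.card_fin, nsmul_eq_mul] at h0
  have hdpos : (0 : ℝ) < d := by exact_mod_cast Nat.pos_of_ne_zero (NeZero.ne d)
  nlinarith

end CoordinateResampling

/-! ### Overlap of the laws after many steps, by a coupling argument in dual form. -/

section Contraction

variable {d : ℕ}

theorem integral_sub_le_mul_tvDist {X : Type*} [MeasurableSpace X] (μ ν : Measure X)
    [IsProbabilityMeasure μ] [IsProbabilityMeasure ν] {a : ℝ} (ha : 0 ≤ a) {w : X → ℝ}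
    (hw : Measurable w) (hwa : ∀ x, 0 ≤ w x ∧ w x ≤ a) :
    ∫ x, w x ∂μ - ∫ x, w x ∂ν ≤ a * tvDist μ ν := by
  have hwb := mem_boundedMeasurable_of_mem_Icc hw hwa
  have hlayer : ∀ (ρ : Measure X) [IsProbabilityMeasure ρ],
      ∫ x, w x ∂ρ = ∫ t in Set.Ioc 0 a, ρ.real {x | t ≤ w x} := fun ρ _ =>
    (integrable_of_bounded hwb ρ).integral_eq_integral_Ioc_meas_le
      (ae_of_all _ fun x => (hwa x).1) (ae_of_all _ fun x => (hwa x).2)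
  have hint : ∀ (ρ : Measure X) [IsProbabilityMeasure ρ],
      Integrable (fun t => ρ.real {x | t ≤ w x}) (volume.restrict (Set.Ioc 0 a)) := by
    intro ρ _
    have hanti : Antitone fun t => ρ.real {x | t ≤ w x} := fun s t hst =>
      measureReal_mono fun x (hx : t ≤ w x) => hst.trans hx
    refine Integrable.of_bound hanti.measurable.aestronglyMeasurable 1 (ae_of_all _ fun t => ?_)
    rw [Real.norm_eq_abs, abs_of_nonneg measureReal_nonneg]
    exact measureReal_le_one
  rw [hlayer μ, hlayer ν, ← integral_sub (hint μ) (hint ν)]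
  calc ∫ t in Set.Ioc 0 a, (μ.real {x | t ≤ w x} - ν.real {x | t ≤ w x})
      ≤ ∫ _ in Set.Ioc 0 a, tvDist μ ν := by
        refine integral_mono ((hint μ).sub (hint ν)) (integrable_const _) fun t => ?_
        exact (le_abs_self _).trans
          (abs_measureReal_sub_le_tvDist μ ν (measurableSet_le measurable_const hw))
    _ = a * tvDist μ ν := by
        simp [ha]

/-- One coupled step: if `u - v ≤ 1 - a` pointwise then, up to total variation distance `θ`, the
integrals differ by at most `1 - (1 - θ) a`. -/
theorem integral_sub_integral_le {X : Type*} [MeasurableSpace X] {μ ν : Measure X}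
    [IsProbabilityMeasure μ] [IsProbabilityMeasure ν] {θ : ℝ} (hθ1 : θ ≤ 1)
    (htv : tvDist μ ν ≤ θ) {u v : X → ℝ} (hu : Measurable u) (hv : Measurable v)
    (hu01 : ∀ x, 0 ≤ u x ∧ u x ≤ 1) (hv01 : ∀ x, 0 ≤ v x ∧ v x ≤ 1) {a : ℝ}
    (huv : ∀ x, u x - v x ≤ 1 - a) :
    ∫ x, u x ∂μ - ∫ x, v x ∂ν ≤ 1 - (1 - θ) * a := by
  have iu := integrable_of_bounded (mem_boundedMeasurable_of_mem_Icc hu hu01) μ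
  have iv := integrable_of_bounded (mem_boundedMeasurable_of_mem_Icc hv hv01) ν
  rcases le_or_gt a 0 with ha | ha
  -- A negative `a` does occur: the coupon-collector bound `1 - |D| (1 - 1/d) ^ n` is negative for
  -- small `n`.
  · have h1 : ∫ x, u x ∂μ ≤ 1 := by
      have := integral_mono iu (integrable_const 1) fun x => (hu01 x).2
      simpa using this
    have h2 : 0 ≤ ∫ x, v x ∂ν := integral_nonneg fun x => (hv01 x).1
    nlinarith
  -- Truncating `v` at `a` keeps `u ≤ w + (1 - a)` and cuts the oscillation to `a`, so changing
  -- measure costs only `a θ`.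
  · set w : X → ℝ := fun x => min (v x) a with hw
    have hwm : Measurable w := hv.min measurable_const
    have hwa : ∀ x, 0 ≤ w x ∧ w x ≤ a := fun x => ⟨le_min (hv01 x).1 ha.le, min_le_right _ _⟩
    have hwb := mem_boundedMeasurable_of_mem_Icc hwm hwa
    have h1 : ∫ x, u x ∂μ ≤ ∫ x, w x ∂μ + (1 - a) := by
      have := integral_mono iu ((integrable_of_bounded hwb μ).add (integrable_const (1 - a)))
        fun x => by
          simp only [Pi.add_apply, hw]
          rcases le_total (v x) a with hva | hva
          · rw [min_eq_left hva]; linarith [huv x]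
          · rw [min_eq_right hva]; linarith [(hu01 x).2]
      rw [integral_add' (integrable_of_bounded hwb μ) (integrable_const _)] at this
      simpa using this
    have h2 := integral_sub_le_mul_tvDist μ ν ha.le hwm hwa
    have h3 : ∫ x, w x ∂ν ≤ ∫ x, v x ∂ν :=
      integral_mono (integrable_of_bounded hwb ν) iv fun x => min_le_left _ _
    nlinarith [mul_le_mul_of_nonneg_left htv ha.le]

/-- A successful coupled update puts the same value in both copies, so they stay within the radius
where TV continuity gives `θ`. -/
theorem dist_setCoord_le (k : Fin d) (x y : E d) (t : ℝ) :
    dist (setCoord k x t) (setCoord k y t) ≤ dist x y := by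
  rw [EuclideanSpace.dist_eq, EuclideanSpace.dist_eq]
  refine Real.sqrt_le_sqrt (Finset.sum_le_sum fun j _ => ?_)
  by_cases h : j = k
  · subst h
    rw [setCoord_self, setCoord_self, dist_self, zero_pow two_ne_zero]
    positivity
  · rw [setCoord_of_ne h, setCoord_of_ne h]

theorem norm_dropCoord_sub_le (k : Fin d) (x y : E d) :
    ‖dropCoord k x - dropCoord k y‖ ≤ dist x y := by
  rw [← dist_eq_norm, EuclideanSpace.dist_eq, EuclideanSpace.dist_eq]
  refine Real.sqrt_le_sqrt ?_
  have h : ∑ j : {j : Fin d // j ≠ k}, dist (dropCoord k x j) (dropCoord k y j) ^ 2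
      = ∑ j ∈ Finset.univ.filter (fun j => j ≠ k), dist (x j) (y j) ^ 2 :=
    (Finset.sum_subtype (p := fun j => j ≠ k) (F := inferInstance)
      (Finset.univ.filter fun j => j ≠ k) (by simp) fun j => dist (x j) (y j) ^ 2).symm
  rw [h]
  exact Finset.sum_le_sum_of_subset_of_nonneg (Finset.filter_subset _ _) fun _ _ _ => by positivity

theorem avg_mem_Icc {X : Type*} [MeasurableSpace X] (P : Kernel X X) [IsMarkovKernel P]
    {f : boundedMeasurable X} (hf : ∀ x, 0 ≤ f.1 x ∧ f.1 x ≤ 1) (x : X) :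
    0 ≤ (avg P f).1 x ∧ (avg P f).1 x ≤ 1 := by
  rw [avg_apply]
  refine ⟨integral_nonneg fun y => (hf y).1, ?_⟩
  have := integral_mono (integrable_of_bounded f.2 (P x)) (integrable_const 1) fun y => (hf y).2
  simpa using this

/-- Contraction of the random-scan Gibbs kernel on the points at distance at most `Δ`: with
probability at least `1 - |D| (1 - 1/d)^n` all the coordinates in `D` are resampled within `n`
steps, and each step of the coupling succeeds with probability at least `1 - θ`. -/
theorem avg_randomScan_pow_sub_le [NeZero d] {κ : (k : Fin d) → Kernel (ECompl k) ℝ}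
    [∀ k, IsMarkovKernel (κ k)] {Δ θ : ℝ} (hθ1 : θ ≤ 1)
    (htv : ∀ (k : Fin d) (x y : E d), dist x y ≤ Δ →
      tvDist (κ k (dropCoord k x)) (κ k (dropCoord k y)) ≤ θ)
    {g : boundedMeasurable (E d)} (hg : ∀ x, 0 ≤ g.1 x ∧ g.1 x ≤ 1) (n : ℕ) (D : Finset (Fin d))
    (x y : E d) (hD : ∀ j ∉ D, x j = y j) (hxy : dist x y ≤ Δ) :
    ((avg (randomScan κ) ^ n) g).1 x - ((avg (randomScan κ) ^ n) g).1 y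
      ≤ 1 - (1 - θ) ^ n * (1 - D.card * (1 - (d : ℝ)⁻¹) ^ n) := by
  induction n generalizing D x y with
  | zero =>
    simp only [pow_zero, Module.End.one_apply, mul_one, one_mul]
    rcases D.eq_empty_or_nonempty with rfl | hne
    · have : x = y := by
        ext j
        exact hD j (by simp)
      simp [this]
    · have : (1 : ℝ) ≤ D.card := by exact_mod_cast hne.card_pos
      linarith [(hg x).2, (hg y).1]
  | succ n ih =>
    have hd : (d : ℝ) ≠ 0 := by exact_mod_cast NeZero.ne d
    have hdpos : (0 : ℝ) < d := by exact_mod_cast Nat.pos_of_ne_zero (NeZero.ne d)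
    rw [pow_succ' (avg (randomScan κ)), Module.End.mul_apply]
    set h := (avg (randomScan κ) ^ n) g with hh
    have h01 : ∀ x, 0 ≤ h.1 x ∧ h.1 x ≤ 1 := by
      rw [hh, ← avg_pow]
      exact avg_mem_Icc _ hg
    have hex : ∀ x, (avg (randomScan κ) h).1 x
        = (d : ℝ)⁻¹ * ∑ k, ∫ t, h.1 (setCoord k x t) ∂κ k (dropCoord k x) := by
      intro x
      rw [avg_randomScan]
      simp [Finset.sum_apply, ← avg_coordKernel_apply]
    -- After the common update of coordinate `k` the copies can differ only on `D.erase k`.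
    have hstep : ∀ k, ∫ t, h.1 (setCoord k x t) ∂κ k (dropCoord k x)
        - ∫ t, h.1 (setCoord k y t) ∂κ k (dropCoord k y)
        ≤ 1 - (1 - θ) * ((1 - θ) ^ n * (1 - (D.erase k).card * (1 - (d : ℝ)⁻¹) ^ n)) := by
      intro k
      refine integral_sub_integral_le hθ1 (htv k x y hxy)
        (h.2.1.comp (measurable_setCoord_right k x)) (h.2.1.comp (measurable_setCoord_right k y))
        (fun t => h01 _) (fun t => h01 _) fun t => ?_
      refine ih (D.erase k) _ _ (fun j hj => ?_) ((dist_setCoord_le k x y t).trans hxy)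
      by_cases hjk : j = k
      · subst hjk
        rw [setCoord_self, setCoord_self]
      · rw [setCoord_of_ne hjk, setCoord_of_ne hjk]
        exact hD j fun hj' => hj (Finset.mem_erase.2 ⟨hjk, hj'⟩)
    -- Averaged over `k`, the size of `D` shrinks by exactly `1 - 1/d`; the bound is affine in that
    -- size, so the induction closes with equality.
    have hcard : ∑ k, ((D.erase k).card : ℝ) = (d - 1) * D.card := by
      have h1 : ∀ k, ((D.erase k).card : ℝ) = D.card - if k ∈ D then 1 else 0 := by
        intro k
        split_ifs with hk
        · rw [Finset.card_erase_of_mem hk, Nat.cast_sub (Finset.card_pos.2 ⟨k, hk⟩), Nat.cast_one]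
        · rw [Finset.erase_eq_of_notMem hk, sub_zero]
      simp only [h1]
      rw [Finset.sum_sub_distrib, Finset.sum_ite_mem, Finset.univ_inter]
      simp
      ring
    rw [hex, hex, ← mul_sub, ← Finset.sum_sub_distrib]
    refine (mul_le_mul_of_nonneg_left (Finset.sum_le_sum fun k _ => hstep k)
      (inv_nonneg.2 hdpos.le)).trans (le_of_eq ?_)
    have hsplit : ∀ k, 1 - (1 - θ) * ((1 - θ) ^ n * (1 - (D.erase k).card * (1 - (d : ℝ)⁻¹) ^ n))
        = (1 - (1 - θ) ^ (n + 1))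
          + ((1 - θ) ^ (n + 1) * (1 - (d : ℝ)⁻¹) ^ n) * (D.erase k).card := fun k => by ring
    simp only [hsplit]
    rw [Finset.sum_add_distrib, ← Finset.mul_sum, hcard]
    simp only [Finset.sum_const, Finset.card_univ, Fintype.card_fin, nsmul_eq_mul]
    have e : (d : ℝ)⁻¹ * (d - 1) = 1 - (d : ℝ)⁻¹ := by field_simp
    calc (d : ℝ)⁻¹ * (d * (1 - (1 - θ) ^ (n + 1))
          + (1 - θ) ^ (n + 1) * (1 - (d : ℝ)⁻¹) ^ n * ((d - 1) * D.card))
        = (d : ℝ)⁻¹ * d * (1 - (1 - θ) ^ (n + 1))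
          + (1 - θ) ^ (n + 1) * (1 - (d : ℝ)⁻¹) ^ n * ((d : ℝ)⁻¹ * (d - 1)) * D.card := by ring
      _ = _ := by rw [inv_mul_cancel₀ hd, e]; ring

theorem randomScan_pow_sub_le [NeZero d] {κ : (k : Fin d) → Kernel (ECompl k) ℝ}
    [∀ k, IsMarkovKernel (κ k)] {Δ θ : ℝ} (hθ1 : θ ≤ 1)
    (htv : ∀ (k : Fin d) (x y : E d), dist x y ≤ Δ →
      tvDist (κ k (dropCoord k x)) (κ k (dropCoord k y)) ≤ θ) (n : ℕ) (x y : E d)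
    (hxy : dist x y ≤ Δ) {S : Set (E d)} (hS : MeasurableSet S) :
    (((randomScan κ) ^ n) x).real S - (((randomScan κ) ^ n) y).real S
      ≤ 1 - (1 - θ) ^ n * (1 - d * (1 - (d : ℝ)⁻¹) ^ n) := by
  have := avg_randomScan_pow_sub_le hθ1 htv (g := boundedIndicator S hS) (fun x => by
    by_cases hx : x ∈ S <;> simp [boundedIndicator, hx]) n Finset.univ x y (by simp) hxy
  rw [← avg_pow, avg_boundedIndicator, avg_boundedIndicator] at this
  simpa using this

end Contraction

/-! ### Isoperimetry from the Poincaré inequality, and conductance from overlap. -/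

section Isoperimetry

variable {d : ℕ}

theorem modGrad_le_of_lipschitz {f : E d → ℝ} {K : ℝ≥0} (hf : LipschitzWith K f) (x : E d) :
    modGrad f x ≤ K := by
  refine limsup_le_of_le (by isBoundedDefault) (Eventually.of_forall fun y => ?_)
  exact ENNReal.div_le_of_le_mul (hf y x)

theorem modGrad_eq_zero {f : E d → ℝ} {x : E d} (hf : ∀ᶠ y in 𝓝 x, f y = f x) :
    modGrad f x = 0 := by
  refine le_antisymm (limsup_le_of_le (by isBoundedDefault) ?_) bot_le
  filter_upwards [nhdsWithin_le_nhds hf] with y hy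
  simp [hy]

/-- Three-set isoperimetric inequality from the `L^q`-Poincaré inequality. -/
theorem isoperimetry {π : Measure (E d)} [IsProbabilityMeasure π] {q C : ℝ} (hq : 1 ≤ q)
    (hC : 0 < C) (hP : PoincareIneq π q C) {Δ : ℝ} (hΔ : 0 < Δ) {A B : Set (E d)}
    (hA : MeasurableSet A) (hB : MeasurableSet B) (hAB : ∀ x ∈ A, ∀ y ∈ B, Δ < dist x y) :
    ENNReal.ofReal (C * (Δ / 3) ^ q) * min (π A) (π B) ≤ π (A ∪ B)ᶜ := by
  have hq0 : 0 < q := by linarith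
  -- The distance to `∅` is `0` by convention, so the lower bound on `B` below needs `A` nonempty.
  rcases A.eq_empty_or_nonempty with rfl | hne
  · simp
  set K : ℝ≥0 := ⟨3 / (2 * Δ), by positivity⟩ with hK
  -- The ramp rises from distance `Δ/6` to `5Δ/6`, leaving margins on which `f` is constant near
  -- every point of `A` and `B`. So `modGrad f` vanishes on these sets, whatever mass their
  -- boundaries carry.
  set ℓ : E d → ℝ := fun x => 3 / (2 * Δ) * (Metric.infDist x A - Δ / 6) with hℓ
  set f : E d → ℝ := fun x => max 0 (min 1 (ℓ x)) with hf
  have hℓlip : LipschitzWith K ℓ := by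
    refine LipschitzWith.of_dist_le_mul fun x y => ?_
    have h1 := (Metric.lipschitz_infDist_pt A).dist_le_mul x y
    rw [NNReal.coe_one, one_mul, Real.dist_eq] at h1
    rw [Real.dist_eq, hℓ]
    simp only
    rw [← mul_sub, sub_sub_sub_cancel_right, abs_mul,
      abs_of_pos (by positivity : 0 < 3 / (2 * Δ))]
    exact mul_le_mul_of_nonneg_left h1 (by positivity)
  have hflip : LipschitzWith K f := (hℓlip.const_min 1).const_max 0
  have hf01 : ∀ x, 0 ≤ f x ∧ f x ≤ 1 := fun x =>
    ⟨le_max_left _ _, max_le zero_le_one (min_le_left _ _)⟩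
  have hfb := mem_boundedMeasurable_of_mem_Icc hflip.continuous.measurable hf01
  have hlow : ∀ x, Metric.infDist x A ≤ Δ / 6 → f x = 0 := fun x hx => by
    have : ℓ x ≤ 0 := mul_nonpos_of_nonneg_of_nonpos (by positivity) (by linarith)
    rw [hf]
    simp only
    rw [max_eq_left ((min_le_right _ _).trans this)]
  have hhigh : ∀ x, 5 * Δ / 6 ≤ Metric.infDist x A → f x = 1 := fun x hx => by
    have : 1 ≤ ℓ x := by
      have h1 : 3 / (2 * Δ) * (2 * Δ / 3) = 1 := by field_simp
      rw [← h1]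
      exact mul_le_mul_of_nonneg_left (by linarith) (by positivity)
    rw [hf]
    simp only
    rw [min_eq_left this, max_eq_right zero_le_one]
  have hinf : Continuous fun x => Metric.infDist x A := Metric.continuous_infDist_pt A
  have hAinf : ∀ x ∈ A, Metric.infDist x A = 0 := fun x hx => Metric.infDist_zero_of_mem hx
  have hBinf : ∀ x ∈ B, Δ ≤ Metric.infDist x A := fun x hx =>
    (Metric.le_infDist hne).2 fun y hy => by rw [dist_comm]; exact (hAB y hy x hx).le
  have hfA : ∀ x ∈ A, f x = 0 := fun x hx => hlow x (by rw [hAinf x hx]; positivity)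
  have hfB : ∀ x ∈ B, f x = 1 := fun x hx => hhigh x (by linarith [hBinf x hx])
  have hgA : ∀ x ∈ A, modGrad f x = 0 := fun x hx => by
    refine modGrad_eq_zero ?_
    have : ∀ᶠ y in 𝓝 x, Metric.infDist y A < Δ / 6 :=
      hinf.continuousAt.eventually_lt_const (by simp only [hAinf x hx]; positivity)
    filter_upwards [this] with y hy
    rw [hlow y hy.le, hfA x hx]
  have hgB : ∀ x ∈ B, modGrad f x = 0 := fun x hx => by
    refine modGrad_eq_zero ?_
    have : ∀ᶠ y in 𝓝 x, 5 * Δ / 6 < Metric.infDist y A :=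
      hinf.continuousAt.eventually_const_lt (by linarith [hBinf x hx])
    filter_upwards [this] with y hy
    rw [hhigh y hy.le, hfB x hx]
  have hpoin := hP f (fun x r => ⟨K, hflip.lipschitzOnWith⟩) (integrable_of_bounded hfb π)
  set m := ∫ y, f y ∂π with hm
  have hup : ∫⁻ x, modGrad f x ^ q ∂π ≤ (K : ℝ≥0∞) ^ q * π (A ∪ B)ᶜ := by
    rw [← lintegral_indicator_const (hA.union hB).compl]
    refine lintegral_mono fun x => ?_
    by_cases hx : x ∈ A ∪ B
    · have : modGrad f x = 0 := hx.elim (hgA x) (hgB x)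
      simp only [this]
      rw [ENNReal.zero_rpow_of_pos hq0]
      exact bot_le
    · rw [Set.indicator_of_mem (show x ∈ (A ∪ B)ᶜ from hx)]
      exact ENNReal.rpow_le_rpow (modGrad_le_of_lipschitz hflip x) hq0.le
  -- The mean is at distance at least `1 / 2` from one of the values `0` and `1`. Dividing `1 / 2`
  -- by the slope `3 / (2Δ)` yields `Δ / 3`.
  have hdown : ENNReal.ofReal ((1 / 2) ^ q) * min (π A) (π B)
      ≤ ∫⁻ x, (ENNReal.ofReal |f x - m|) ^ q ∂π := by
    have hset : ∀ {S : Set (E d)}, MeasurableSet S → (∀ x ∈ S, 1 / 2 ≤ |f x - m|) →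
        ENNReal.ofReal ((1 / 2) ^ q) * π S ≤ ∫⁻ x, (ENNReal.ofReal |f x - m|) ^ q ∂π := by
      intro S hS hx
      rw [← lintegral_indicator_const hS]
      refine lintegral_mono fun x => ?_
      by_cases hxS : x ∈ S
      · rw [Set.indicator_of_mem hxS, ENNReal.ofReal_rpow_of_nonneg (abs_nonneg _) hq0.le]
        exact ENNReal.ofReal_le_ofReal
          (Real.rpow_le_rpow (by norm_num) (hx x hxS) hq0.le)
      · rw [Set.indicator_of_notMem hxS]
        exact bot_le
    rcases le_total m (1 / 2) with hm2 | hm2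
    · refine (mul_le_mul_right (min_le_right _ _) _).trans (hset hB fun x hx => ?_)
      rw [hfB x hx]
      exact (by linarith : (1 : ℝ) / 2 ≤ 1 - m).trans (le_abs_self _)
    · refine (mul_le_mul_right (min_le_left _ _) _).trans (hset hA fun x hx => ?_)
      rw [hfA x hx, zero_sub, abs_neg]
      exact hm2.trans (le_abs_self _)
  have hmain := hdown.trans (hpoin.trans (mul_le_mul_right hup _))
  have hKq : (K : ℝ≥0∞) ^ q = ENNReal.ofReal ((3 / (2 * Δ)) ^ q) := by
    rw [← ENNReal.ofReal_rpow_of_nonneg (by positivity) hq0.le]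
    congr 1
    rw [ENNReal.ofReal, Real.toNNReal_of_nonneg (by positivity)]
    rfl
  have hcoef : C * (Δ / 3) ^ q = C * (2 * Δ / 3) ^ q * (1 / 2) ^ q := by
    rw [mul_assoc, ← Real.mul_rpow (by positivity) (by norm_num)]
    congr 2
    ring
  rw [hKq, ← mul_assoc, ← ENNReal.ofReal_inv_of_pos hC, ← ENNReal.ofReal_mul (by positivity)]
    at hmain
  have hone : C * (2 * Δ / 3) ^ q * (C⁻¹ * (3 / (2 * Δ)) ^ q) = 1 := by
    have : (2 * Δ / 3) ^ q * (3 / (2 * Δ)) ^ q = 1 := by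
      rw [← Real.mul_rpow (by positivity) (by positivity)]
      have : 2 * Δ / 3 * (3 / (2 * Δ)) = 1 := by field_simp
      rw [this, Real.one_rpow]
    calc _ = C * C⁻¹ * ((2 * Δ / 3) ^ q * (3 / (2 * Δ)) ^ q) := by ring
      _ = 1 := by rw [this, mul_inv_cancel₀ hC.ne', one_mul]
  calc ENNReal.ofReal (C * (Δ / 3) ^ q) * min (π A) (π B)
      = ENNReal.ofReal (C * (2 * Δ / 3) ^ q) * (ENNReal.ofReal ((1 / 2) ^ q) * min (π A) (π B)) := by
        rw [hcoef, ENNReal.ofReal_mul (by positivity), mul_assoc]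
    _ ≤ ENNReal.ofReal (C * (2 * Δ / 3) ^ q)
        * (ENNReal.ofReal (C⁻¹ * (3 / (2 * Δ)) ^ q) * π (A ∪ B)ᶜ) := mul_le_mul_right hmain _
    _ = π (A ∪ B)ᶜ := by
        rw [← mul_assoc, ← ENNReal.ofReal_mul (by positivity), hone, ENNReal.ofReal_one, one_mul]

theorem ofReal_mul_natCast_mul {c : ℝ} (hc : 0 ≤ c) (n : ℕ) (t : ℝ≥0∞) :
    ENNReal.ofReal c * (n * t) = ENNReal.ofReal (c * n) * t := by
  rw [← mul_assoc, ← ENNReal.ofReal_natCast n, ← ENNReal.ofReal_mul hc]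

theorem le_two_mul_of_four_mul_lt {a u v : ℝ≥0∞} (ha : a ≠ ⊤) (hu : u ≠ ⊤) (hv : v ≠ ⊤)
    (h : a ≤ u + v) (h4 : 4 * v < a) : a ≤ 2 * u := by
  lift a to ℝ≥0 using ha
  lift u to ℝ≥0 using hu
  lift v to ℝ≥0 using hv
  have h1 : (a : ℝ) ≤ u + v := by exact_mod_cast h
  have h2 : 4 * (v : ℝ) < a := by exact_mod_cast h4
  have h3 : (a : ℝ) ≤ 2 * u := by linarith [v.coe_nonneg]
  exact_mod_cast h3

/-- Conductance of a kernel whose transition laws overlap at nearby points. -/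
theorem flow_ge_of_overlap {P : Kernel (E d) (E d)} [IsMarkovKernel P] {π : Measure (E d)}
    [IsProbabilityMeasure π] (h : P.Invariant π) {q C : ℝ} (hq : 1 ≤ q)
    (hC : 0 < C) (hP : PoincareIneq π q C) {Δ p : ℝ} (hΔ : 0 < Δ) (hp : 0 ≤ p)
    (hov : ∀ x y, dist x y ≤ Δ → ∀ S, MeasurableSet S → (P x).real S - (P y).real S ≤ 1 - p)
    {S : Set (E d)} (hS : MeasurableSet S) (hS2 : π S ≤ 1 / 2) :
    ENNReal.ofReal (p / 8 * min 1 (C * (Δ / 3) ^ q)) * π S ≤ flow π P S := by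
  set r : ℝ≥0∞ := ENNReal.ofReal (p / 2) with hr
  have hr4 : ENNReal.ofReal (p / 8 * min 1 (C * (Δ / 3) ^ q))
      = r * ENNReal.ofReal (1 / 4 * min 1 (C * (Δ / 3) ^ q)) := by
    rw [hr, ← ENNReal.ofReal_mul (by positivity)]
    congr 1
    ring
  set A : Set (E d) := S ∩ {x | P x Sᶜ < r} with hA
  set B : Set (E d) := Sᶜ ∩ {x | P x S < r} with hB
  have hAm : MeasurableSet {x | P x Sᶜ < r} :=
    measurableSet_lt (P.measurable_coe hS.compl) measurable_const
  have hBm : MeasurableSet {x | P x S < r} :=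
    measurableSet_lt (P.measurable_coe hS) measurable_const
  have hflow1 : r * π (S \ A) ≤ flow π P S := by
    rw [flow, ← setLIntegral_const]
    refine le_trans ?_ (lintegral_mono_set (Set.sdiff_subset (t := A)))
    refine setLIntegral_mono' (hS.diff (hS.inter hAm)) fun x hx => ?_
    by_contra! hlt
    exact hx.2 ⟨hx.1, hlt⟩
  have hflow2 : r * π (Sᶜ \ B) ≤ flow π P S := by
    rw [← flow_compl h hS, flow, ← setLIntegral_const]
    refine le_trans ?_ (lintegral_mono_set (Set.sdiff_subset (t := B)))
    refine setLIntegral_mono' (hS.compl.diff (hS.compl.inter hBm)) fun x hx => ?_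
    rw [compl_compl]
    by_contra! hlt
    exact hx.2 ⟨hx.1, hlt⟩
  have hSc : π S ≤ π Sᶜ := by
    rw [prob_compl_eq_one_sub hS]
    refine hS2.trans ?_
    have := tsub_le_tsub_left hS2 1
    refine le_trans ?_ this
    norm_num
  have hquarter : ∀ t : ℝ≥0∞, π S ≤ 4 * t →
      ENNReal.ofReal (1 / 4 * min 1 (C * (Δ / 3) ^ q)) * π S ≤ t := by
    intro t ht
    calc _ ≤ ENNReal.ofReal (1 / 4) * (4 * t) := by
          refine mul_le_mul' (ENNReal.ofReal_le_ofReal ?_) ht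
          have := min_le_left 1 (C * (Δ / 3) ^ q)
          linarith
      _ = t := by
          have := ofReal_mul_natCast_mul (by norm_num : (0 : ℝ) ≤ 1 / 4) 4 t
          norm_num at this ⊢
          exact this
  rw [hr4, mul_assoc]
  -- If points likely to cross, with probability at least `p / 2`, carry a quarter of `π S` on
  -- either side, they give the flow directly. Otherwise `A` and `B` both have mass at least `π S /
  -- 2`.
  by_cases hcA : π S ≤ 4 * π (S \ A)
  · exact (mul_le_mul_right (hquarter _ hcA) _).trans hflow1
  by_cases hcB : π S ≤ 4 * π (Sᶜ \ B)
  · exact (mul_le_mul_right (hquarter _ hcB) _).trans hflow2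
  push Not at hcA hcB
  have hbig : ∀ (T U : Set (E d)), π S ≤ π T → 4 * π (T \ U) < π S → π S ≤ 2 * π U := by
    intro T U hST hlt
    refine le_two_mul_of_four_mul_lt (measure_ne_top _ _) (measure_ne_top _ _)
      (measure_ne_top _ _) (hST.trans ?_) hlt
    refine (measure_mono fun x hx => ?_).trans (measure_union_le U (T \ U))
    by_cases hU : x ∈ U
    · exact Or.inl hU
    · exact Or.inr ⟨hx, hU⟩
  have hA2 := hbig S A le_rfl hcA
  have hB2 := hbig Sᶜ B hSc hcB
  -- Points of `A` and `B` at distance at most `Δ` would satisfy `P x S - P y S > (1 - p/2) - p/2`,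
  -- against the overlap.
  have hdist : ∀ x ∈ A, ∀ y ∈ B, Δ < dist x y := by
    intro x hx y hy
    by_contra! hle
    have h1 := hov x y hle S hS
    have h2 : (P x).real Sᶜ < p / 2 := by
      rw [measureReal_def]
      exact (ENNReal.toReal_lt_of_lt_ofReal hx.2)
    have h3 : (P y).real S < p / 2 := by
      rw [measureReal_def]
      exact (ENNReal.toReal_lt_of_lt_ofReal hy.2)
    rw [probReal_compl_eq_one_sub hS] at h2
    linarith
  have hiso := isoperimetry hq hC hP hΔ (hS.inter hAm) (hS.compl.inter hBm) hdist
  have hrest : π (A ∪ B)ᶜ ≤ π (S \ A) + π (Sᶜ \ B) := by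
    refine (measure_mono fun x hx => ?_).trans (measure_union_le _ _)
    by_cases hxS : x ∈ S
    · exact Or.inl ⟨hxS, fun hxA => hx (Or.inl hxA)⟩
    · exact Or.inr ⟨hxS, fun hxB => hx (Or.inr hxB)⟩
  have hmin : π S ≤ 2 * min (π A) (π B) := by
    rcases le_total (π A) (π B) with hab | hab
    · rwa [min_eq_left hab]
    · rwa [min_eq_right hab]
  have h4 : ENNReal.ofReal (1 / 4 * min 1 (C * (Δ / 3) ^ q)) * π S
      ≤ ENNReal.ofReal (1 / 2) * (π (S \ A) + π (Sᶜ \ B)) := by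
    calc _ ≤ ENNReal.ofReal (1 / 4 * (C * (Δ / 3) ^ q)) * (2 * min (π A) (π B)) := by
          refine mul_le_mul' (ENNReal.ofReal_le_ofReal ?_) hmin
          exact mul_le_mul_of_nonneg_left (min_le_right _ _) (by norm_num)
      _ = ENNReal.ofReal (1 / 2) * (ENNReal.ofReal (C * (Δ / 3) ^ q) * min (π A) (π B)) := by
          have := ofReal_mul_natCast_mul (by positivity : 0 ≤ 1 / 4 * (C * (Δ / 3) ^ q)) 2
            (min (π A) (π B))
          rw [Nat.cast_ofNat] at this
          rw [this, ← mul_assoc (ENNReal.ofReal (1 / 2)), ← ENNReal.ofReal_mul (by norm_num)]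
          congr 2
          push_cast
          ring
      _ ≤ _ := mul_le_mul_right (hiso.trans hrest) _
  calc r * (ENNReal.ofReal (1 / 4 * min 1 (C * (Δ / 3) ^ q)) * π S)
      ≤ r * (ENNReal.ofReal (1 / 2) * (π (S \ A) + π (Sᶜ \ B))) := mul_le_mul_right h4 _
    _ = ENNReal.ofReal (1 / 2) * (r * π (S \ A) + r * π (Sᶜ \ B)) := by ring
    _ ≤ ENNReal.ofReal (1 / 2) * (flow π P S + flow π P S) :=
        mul_le_mul_right (add_le_add hflow1 hflow2) _
    _ = flow π P S := by
        have := ofReal_mul_natCast_mul (by norm_num : (0 : ℝ) ≤ 1 / 2) 2 (flow π P S)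
        rw [← two_mul]
        norm_num at this ⊢
        exact this

end Isoperimetry

/-! ### Choice of scales and constants for the random scan. -/

section RandomScan

variable {d : ℕ}

theorem conductance_ge {P : Kernel (E d) (E d)} [IsMarkovKernel P] {π : Measure (E d)}
    [IsProbabilityMeasure π] (h : P.Invariant π) {n : ℕ} {φ r : ℝ} (hr : r * n ≤ φ)
    (hn : 0 < n)
    (hflow : ∀ S, MeasurableSet S → π S ≤ 1 / 2 → ENNReal.ofReal φ * π S ≤ flow π (P ^ n) S) :
    ENNReal.ofReal r ≤ conductance π P := by
  refine le_iInf fun S => le_iInf fun hS => le_iInf fun hpos => le_iInf fun hle => ?_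
  rw [ENNReal.le_div_iff_mul_le (Or.inl hpos.ne') (Or.inl (measure_ne_top _ _))]
  have h1 := (hflow S hS hle).trans (flow_pow_le h hS n)
  have hn' : (n : ℝ≥0∞) ≠ 0 := by exact_mod_cast hn.ne'
  rw [← ENNReal.mul_le_mul_iff_right hn' (ENNReal.natCast_ne_top n)]
  refine le_trans ?_ h1
  rw [← mul_assoc, ← ENNReal.ofReal_natCast n, ← ENNReal.ofReal_mul (Nat.cast_nonneg n)]
  exact mul_le_mul_left (ENNReal.ofReal_le_ofReal (by linarith)) _

theorem spectralGap_ge {P : Kernel (E d) (E d)} {π : Measure (E d)} {l : ℝ}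
    (hgap : ∀ f : E d → ℝ, MemLp f 2 π → ∫ x, f x ∂π = 0 →
      l * ∫ x, f x ^ 2 ∂π ≤ ∫ x, f x * (f x - ∫ y, f y ∂(P x)) ∂π) :
    (l : EReal) ≤ spectralGap π P := by
  refine le_iInf fun f => le_iInf fun hf => le_iInf fun h0 => le_iInf fun hne => ?_
  rw [EReal.coe_le_coe_iff]
  have hpos : 0 < ∫ x, f x ^ 2 ∂π := (integral_nonneg fun x => sq_nonneg (f x)).lt_of_ne' hne
  rw [le_div_iff₀ hpos]
  exact hgap f hf h0

theorem overlap_lower_bound {d : ℕ} (hd : 2 ≤ d) {s : ℝ} (hs0 : 0 ≤ s) (hs3 : s ≤ 3)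
    (hsd : s ≤ 12 / 13 * (d * Real.log d)) (h1 : 1 ≤ d * Real.log d) :
    Real.exp (-117) / 2 ≤ (1 - s / (d * Real.log d)) ^ ⌈2 * (d * Real.log d)⌉₊
      * (1 - d * (1 - (d : ℝ)⁻¹) ^ ⌈2 * (d * Real.log d)⌉₊) := by
  have hd2 : (2 : ℝ) ≤ d := by exact_mod_cast hd
  have hd0 : (0 : ℝ) < d := by linarith
  set Λ := d * Real.log d with hΛ
  set n := ⌈2 * Λ⌉₊ with hn
  have hn1 : 2 * Λ ≤ n := Nat.le_ceil _
  have hn2 : (n : ℝ) < 2 * Λ + 1 := Nat.ceil_lt_add_one (by linarith)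
  have hΛ0 : 0 < Λ := by linarith
  set θ := s / Λ with hθ
  have hθ0 : 0 ≤ θ := div_nonneg hs0 hΛ0.le
  have hθ1 : θ ≤ 12 / 13 := by rw [hθ, div_le_iff₀ hΛ0]; exact hsd
  -- `1 + 13θ ≥ 1 / (1 - θ)` holds for `0 ≤ θ ≤ 12 / 13`; this is the source of the `12 / 13` in
  -- `hsd`.
  have hexp : Real.exp (-(13 * θ)) ≤ 1 - θ := by
    rw [Real.exp_neg, inv_le_comm₀ (Real.exp_pos _) (by linarith)]
    refine le_trans ?_ (Real.add_one_le_exp (13 * θ))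
    rw [inv_le_iff_one_le_mul₀ (by linarith)]
    nlinarith
  -- `θ Λ = s ≤ 3` and `n ≤ 3Λ`; the exponent `117` is `13 * 9`.
  have hθn : θ * n ≤ 9 := by
    have e : θ * Λ = s := by rw [hθ]; field_simp
    nlinarith
  have hA : Real.exp (-117) ≤ (1 - θ) ^ n := by
    calc Real.exp (-117) ≤ Real.exp (-(13 * θ)) ^ n := by
          rw [← Real.exp_nat_mul]
          exact Real.exp_le_exp.2 (by nlinarith)
      _ ≤ (1 - θ) ^ n := pow_le_pow_left₀ (Real.exp_pos _).le hexp n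
  -- With `n ≥ 2 d log d`, some coordinate is missed with probability at most `d * d⁻² = 1/d`.
  have hB : d * (1 - (d : ℝ)⁻¹) ^ n ≤ 1 / 2 := by
    have hinv : (d : ℝ)⁻¹ ≤ 1 := inv_le_one_of_one_le₀ (by linarith)
    have h2 : (1 - (d : ℝ)⁻¹) ^ n ≤ Real.exp (-(2 * Real.log d)) := by
      calc (1 - (d : ℝ)⁻¹) ^ n ≤ Real.exp (-(d : ℝ)⁻¹) ^ n :=
            pow_le_pow_left₀ (by linarith) (by linarith [Real.add_one_le_exp (-(d : ℝ)⁻¹)]) n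
        _ ≤ Real.exp (-(2 * Real.log d)) := by
            rw [← Real.exp_nat_mul]
            refine Real.exp_le_exp.2 ?_
            have h3 := mul_le_mul_of_nonneg_right hn1 (inv_nonneg.2 hd0.le)
            have e : 2 * Λ * (d : ℝ)⁻¹ = 2 * Real.log d := by rw [hΛ]; field_simp
            linarith
    have e : Real.exp (-(2 * Real.log d)) = (d : ℝ)⁻¹ * (d : ℝ)⁻¹ := by
      rw [two_mul, neg_add, Real.exp_add, Real.exp_neg, Real.exp_log hd0]
    rw [e] at h2
    calc d * (1 - (d : ℝ)⁻¹) ^ n ≤ d * ((d : ℝ)⁻¹ * (d : ℝ)⁻¹) :=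
          mul_le_mul_of_nonneg_left h2 hd0.le
      _ = (d : ℝ)⁻¹ := by field_simp
      _ ≤ 1 / 2 := by rw [inv_le_comm₀ hd0 (by norm_num)]; linarith
  calc Real.exp (-117) / 2 = Real.exp (-117) * (1 / 2) := by ring
    _ ≤ (1 - θ) ^ n * (1 - d * (1 - (d : ℝ)⁻¹) ^ n) :=
      mul_le_mul hA (by linarith) (by norm_num) ((Real.exp_pos _).le.trans hA)

/-- The overlap of the transition laws of `⌈2 d log d⌉` steps of the random-scan Gibbs kernel
started at nearby points. -/
noncomputable def overlapConst : ℝ := Real.exp (-117) / 2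

theorem overlapConst_pos : 0 < overlapConst := half_pos (Real.exp_pos _)

theorem overlapConst_le_one : overlapConst ≤ 1 := by
  have : Real.exp (-117) ≤ 1 := Real.exp_le_one_iff.2 (by norm_num)
  rw [overlapConst]
  linarith

/-- The free scale `s` balances two demands: `s = 3` cancels the `Δ / 3` of `isoperimetry` and
removes the dependence on `q`, while the failure rate `s / Λ` must stay below 1. -/
theorem flow_randomScan_pow_ge (hd : 2 ≤ d) [NeZero d] {q : ℝ} (hq : 1 ≤ q) {s : ℝ} (hs1 : 1 ≤ s)
    (hs3 : s ≤ 3) (hsd : s ≤ 12 / 13 * (d * Real.log d)) {β M C : ℝ} (hβ : 0 < β) (hβ1 : β ≤ 1)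
    (hM : 0 < M) (hC : 0 < C) {π : Measure (E d)} [IsProbabilityMeasure π]
    {κ : (k : Fin d) → Kernel (ECompl k) ℝ} [∀ k, IsMarkovKernel (κ k)]
    (hcond : ∀ k, IsConditional π k (κ k)) (hTV : TVContinuous κ M β) (hP : PoincareIneq π q C)
    {S : Set (E d)} (hS : MeasurableSet S) (hS2 : π S ≤ 1 / 2) :
    ENNReal.ofReal (overlapConst / 8 * (s / 3) ^ q
        * min 1 (C / (M ^ (q / β) * (d * Real.log d) ^ (q / β)))) * π S
      ≤ flow π (randomScan κ ^ ⌈2 * (d * Real.log d)⌉₊) S := by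
  have hΛ1 : 1 ≤ d * Real.log d := by linarith
  have hΛ0 : 0 < d * Real.log d := by linarith
  set Λ := d * Real.log d with hΛ
  have hMΛ : 0 < M * Λ := mul_pos hM hΛ0
  -- `R` solves `M R ^ β = 1 / Λ`, so radius `s * R` gives failure rate `s ^ β / Λ ≤ s / Λ`, and `C
  -- R ^ q` is the ratio in the theorem.
  set R := (M * Λ) ^ (-(1 / β)) with hR
  have hR0 : 0 < R := Real.rpow_pos_of_pos hMΛ _
  have hs0 : 0 < s := by linarith
  have hΔ : 0 < s * R := mul_pos hs0 hR0
  have hRβ : R ^ β = (M * Λ)⁻¹ := by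
    rw [hR, ← Real.rpow_mul hMΛ.le, neg_mul, one_div_mul_cancel hβ.ne', Real.rpow_neg_one]
  have hRq : R ^ q = (M ^ (q / β) * Λ ^ (q / β))⁻¹ := by
    rw [hR, ← Real.rpow_mul hMΛ.le, ← Real.mul_rpow hM.le hΛ0.le, ← Real.rpow_neg hMΛ.le]
    congr 1
    ring
  have hθ1 : s / Λ ≤ 1 := by rw [div_le_one hΛ0]; linarith
  have htv : ∀ (k : Fin d) (x y : E d), dist x y ≤ s * R →
      tvDist (κ k (dropCoord k x)) (κ k (dropCoord k y)) ≤ s / Λ := by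
    intro k x y hxy
    refine (hTV k x y).trans ?_
    calc M * ‖dropCoord k x - dropCoord k y‖ ^ β ≤ M * (s * R) ^ β := by
          refine mul_le_mul_of_nonneg_left ?_ hM.le
          exact Real.rpow_le_rpow (norm_nonneg _) ((norm_dropCoord_sub_le k x y).trans hxy) hβ.le
      _ = s ^ β / Λ := by
          rw [Real.mul_rpow hs0.le hR0.le, hRβ]
          field_simp
      _ ≤ s / Λ := by
          refine div_le_div_of_nonneg_right ?_ hΛ0.le
          calc s ^ β ≤ s ^ (1 : ℝ) := Real.rpow_le_rpow_of_exponent_le hs1 hβ1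
            _ = s := Real.rpow_one s
  have hov : ∀ x y, dist x y ≤ s * R → ∀ S, MeasurableSet S →
      ((randomScan κ ^ ⌈2 * Λ⌉₊) x).real S - ((randomScan κ ^ ⌈2 * Λ⌉₊) y).real S
        ≤ 1 - overlapConst := by
    intro x y hxy S hS
    have h1 := randomScan_pow_sub_le hθ1 htv ⌈2 * Λ⌉₊ x y hxy hS
    have h2 := overlap_lower_bound hd hs0.le hs3 hsd hΛ1
    rw [overlapConst]
    linarith
  have hmain := flow_ge_of_overlap (invariant_pow (invariant_randomScan hcond) ⌈2 * Λ⌉₊) hq hC hP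
    hΔ overlapConst_pos.le hov hS hS2
  refine le_trans (mul_le_mul_left (ENNReal.ofReal_le_ofReal ?_) _) hmain
  have hρ1 : (s / 3) ^ q ≤ 1 :=
    Real.rpow_le_one (by positivity) (by linarith) (by linarith)
  have hρ0 : 0 < (s / 3) ^ q := Real.rpow_pos_of_pos (by positivity) q
  have e : C * (s * R / 3) ^ q = (s / 3) ^ q * (C / (M ^ (q / β) * Λ ^ (q / β))) := by
    rw [mul_div_right_comm, Real.mul_rpow (by positivity) hR0.le, hRq]
    ring
  rw [e, mul_assoc]
  refine mul_le_mul_of_nonneg_left ?_ (by linarith [overlapConst_pos])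
  refine le_min ?_ (mul_le_mul_of_nonneg_left (min_le_right _ _) hρ0.le)
  exact (mul_le_mul_of_nonneg_left (min_le_left _ _) hρ0.le).trans (by linarith)

theorem randomScanBounds (hd : 2 ≤ d) {q : ℝ} (hq : 1 ≤ q) {s : ℝ} (hs1 : 1 ≤ s)
    (hs3 : s ≤ 3) (hsd : s ≤ 12 / 13 * (d * Real.log d)) :
    RandomScanBounds d q (overlapConst ^ 2 / 384 * ((s / 3) ^ q) ^ 2)
      (4 / (overlapConst ^ 2 / 384 * ((s / 3) ^ q) ^ 2)) := by
  intro β M C hβ hβ1 hM hC π _ κ _ hcond hTV hP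
  have : NeZero d := ⟨by omega⟩
  have hflow := fun S hS hS2 =>
    flow_randomScan_pow_ge hd hq hs1 hs3 hsd hβ hβ1 hM hC hcond hTV hP (S := S) hS hS2
  have hinv := invariant_randomScan hcond
  have hΛ1 : 1 ≤ d * Real.log d := by linarith
  have hΛ0 : 0 < d * Real.log d := by linarith
  set Λ := d * Real.log d with hΛ
  set n := ⌈2 * Λ⌉₊ with hn
  have hn2 : (n : ℝ) < 2 * Λ + 1 := Nat.ceil_lt_add_one (by linarith)
  have hn0 : 0 < n := Nat.ceil_pos.2 (by linarith)
  have hn0' : (0 : ℝ) < n := by exact_mod_cast hn0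
  have hρ1 : (s / 3) ^ q ≤ 1 :=
    Real.rpow_le_one (by positivity) (by linarith) (by linarith)
  have hρ0 : 0 < (s / 3) ^ q := Real.rpow_pos_of_pos (by positivity) q
  set ρ := (s / 3) ^ q with hρ
  have hw0 : 0 < C / (M ^ (q / β) * Λ ^ (q / β)) := by positivity
  have hsq : C ^ 2 / (M ^ (2 * q / β) * Λ ^ (2 * q / β))
      = (C / (M ^ (q / β) * Λ ^ (q / β))) ^ 2 := by
    have e : ∀ t : ℝ, 0 < t → t ^ (2 * q / β) = (t ^ (q / β)) ^ 2 := fun t ht => by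
      rw [← Real.rpow_natCast, ← Real.rpow_mul ht.le]
      congr 1
      push_cast
      ring
    rw [e M hM, e Λ hΛ0, div_pow, mul_pow]
  have hsq' : M ^ (2 * q / β) * Λ ^ (2 * q / β) / C ^ 2
      = ((C / (M ^ (q / β) * Λ ^ (q / β))) ^ 2)⁻¹ := by rw [← hsq, inv_div]
  rw [hsq, hsq']
  set w := C / (M ^ (q / β) * Λ ^ (q / β)) with hw
  set m := min 1 w with hm
  have hm0 : 0 < m := lt_min one_pos hw0
  have hm1 : m ≤ 1 := min_le_left _ _
  have hmsq : min 1 (w ^ 2) = m ^ 2 := by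
    rcases le_total 1 w with h | h
    · rw [hm, min_eq_left h, min_eq_left (one_le_pow₀ h), one_pow]
    · rw [hm, min_eq_right h, min_eq_right (pow_le_one₀ hw0.le h)]
  have hmax : max 1 (w ^ 2)⁻¹ = (m ^ 2)⁻¹ := by
    rw [← hmsq]
    rcases le_total 1 (w ^ 2) with h | h
    · rw [min_eq_left h, max_eq_left (inv_le_one_of_one_le₀ h), inv_one]
    · rw [min_eq_right h, max_eq_right (one_le_inv_iff₀.2 ⟨pow_pos hw0 2, h⟩)]
  rw [hmsq, hmax]
  have hp0 := overlapConst_pos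
  have hp1 := overlapConst_le_one
  set p := overlapConst with hp
  set φ := p / 8 * ρ * m with hφ
  have hφ0 : 0 < φ := by positivity
  have hpρ1 : p * ρ ≤ 1 := mul_le_one₀ hp1 hρ0.le hρ1
  have hpρ0 : 0 < p * ρ := mul_pos hp0 hρ0
  set c := p ^ 2 / 384 * ρ ^ 2 with hc
  have hc0 : 0 < c := by positivity
  have hcle : c ≤ p * ρ / 384 := by rw [hc]; nlinarith
  have hgap : ∀ f : E d → ℝ, MemLp f 2 π → ∫ x, f x ∂π = 0 →
      c * (1 / Λ * m ^ 2) * ∫ x, f x ^ 2 ∂π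
        ≤ ∫ x, f x * (f x - ∫ y, f y ∂(randomScan κ x)) ∂π := by
    intro f hf hf0
    refine le_trans ?_ (gap_of_flow_pow hinv (form_avg_randomScan_symm hcond)
      (form_avg_randomScan_le hcond) hn0 hφ0 hflow hf hf0)
    refine mul_le_mul_of_nonneg_right ?_ (integral_nonneg fun x => sq_nonneg _)
    rw [le_div_iff₀ (by positivity)]
    -- With `n ≤ 3Λ`, `φ² / (2n) ≥ φ² / (6Λ)`, and `384 = 64 * 6`.
    have e : φ ^ 2 = c * (1 / Λ * m ^ 2) * (6 * Λ) := by
      rw [hφ, hc]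
      field_simp
      ring
    rw [e]
    exact mul_le_mul_of_nonneg_left (by linarith) (by positivity)
  refine ⟨?_, spectralGap_ge hgap, ?_⟩
  · refine conductance_ge hinv (n := n) ?_ hn0 hflow
    calc c * (1 / Λ * m) * n ≤ c * (1 / Λ * m) * (3 * Λ) :=
          mul_le_mul_of_nonneg_left (by linarith) (by positivity)
      _ = 3 * c * m := by field_simp
      _ ≤ φ := by rw [hφ]; exact mul_le_mul_of_nonneg_right (by linarith) hm0.le
  · intro μ _ Ω ζ hμ hζ hζΩ
    have hl1 : c * (1 / Λ * m ^ 2) ≤ 1 := by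
      have h1 : c ≤ 1 := by linarith
      have h2 : 1 / Λ ≤ 1 := by rw [div_le_one hΛ0]; exact hΛ1
      have h3 : m ^ 2 ≤ 1 := pow_le_one₀ hm0.le hm1
      exact mul_le_one₀ h1 (by positivity) (mul_le_one₀ h2 (by positivity) h3)
    refine (mixingTime_le hinv (form_avg_randomScan_le hcond) hgap (by positivity) hl1 hμ hζ
      hζΩ).trans (le_of_eq ?_)
    congr 1
    field_simp

theorem twelve_thirteenths_mul_ge (hd : 3 ≤ d) : 3 ≤ 12 / 13 * (d * Real.log d) := by
  have hd' : (3 : ℝ) ≤ d := by exact_mod_cast hd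
  -- The case `d = 3` is nearly tight: it amounts to `e ^ 13 ≤ 3 ^ 12`.
  have h3 : 13 / 12 ≤ Real.log 3 := by
    rw [Real.le_log_iff_exp_le (by norm_num)]
    refine le_of_pow_le_pow_left₀ (n := 12) (by norm_num) (by norm_num) ?_
    have h1 : Real.exp (13 / 12) ^ 12 = Real.exp 1 ^ 13 := by
      rw [← Real.exp_nat_mul, ← Real.exp_nat_mul]
      norm_num
    rw [h1]
    exact (pow_le_pow_left₀ (Real.exp_pos 1).le Real.exp_one_lt_d9.le 13).trans (by norm_num)
  have h4 : Real.log 3 ≤ Real.log d := Real.log_le_log (by norm_num) hd'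
  nlinarith

end RandomScan

end Gibbs

theorem mainTheorem2 :
    (∃ c K : ℝ, 0 < c ∧ 0 < K ∧
      ∀ (d : ℕ) (q : ℝ), 3 ≤ d → 1 ≤ q → Gibbs.RandomScanBounds d q c K) ∧
    (∀ q : ℝ, 1 ≤ q → ∃ c K : ℝ, 0 < c ∧ 0 < K ∧ Gibbs.RandomScanBounds 2 q c K) := by
  have hp := Gibbs.overlapConst_pos
  constructor
  -- Here `s = 3`, so `(s / 3) ^ q = 1` and the constants are universal.
  · refine ⟨Gibbs.overlapConst ^ 2 / 384, 4 / (Gibbs.overlapConst ^ 2 / 384), by positivity,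
      by positivity, fun d q hd hq => ?_⟩
    have := Gibbs.randomScanBounds (by omega) hq (by norm_num) le_rfl
      (Gibbs.twelve_thirteenths_mul_ge hd)
    simpa using this
  · intro q hq
    -- For `d = 2`, `Λ = 2 log 2 < 3` rules out `s = 3`. Taking `s = 1` leaves the factor `(1 / 3) ^
    -- q` in the constants.
    refine ⟨_, _, ?_, ?_, Gibbs.randomScanBounds le_rfl hq le_rfl (by norm_num) ?_⟩
    · positivity
    · positivity
    · push_cast
      linarith [Real.log_two_gt_d9]
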